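/- A plane triangulation is a simple graph together with a planar straight-line drawing in which every face, including the outer one, is bounded by three edges (a triangle). Its inner faces are the bounded ones. Two planar straight-line drawings of the same graph are equivalent if the counterclockwise cyclic order of the incident edges at each vertex and the outer face coincide. A crossing-free drawing equivalent to a plane triangulation $T$ is a limit (of vertex placements) of planar straight-line drawings that are equivalent to $T$; it may be degenerate. $T$ is area-universal if for every assignment $\mathcal A$ of nonnegative real numbers to the inner faces of $T$ there is a crossing-free straight-line drawing equivalent to $T$ in which every inner face $f$ has area $\mathcal A(f)$. A graph is $4$-connected if it has more than four vertices and stays connected after the removal of any at most three vertices. Then for every $n\ge 7$ there exists a $4$-connected plane triangulation on $n$ vertices that is area-universal. -/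

import Mathlib

open scoped NNReal Topology

/-- A graph is `k`-connected if it has more than `k` vertices and stays connected after the removal
of any set of fewer than `k` vertices. -/
def IsVertexConnected {V : Type*} [Fintype V] (G : SimpleGraph V) (k : ℕ) : Prop :=
  k < Fintype.card V ∧ ∀ S : Finset V, S.card < k → (G.induce {v | v ∉ S}).Connected

namespace PlaneDrawing

/-- The determinant of two vectors in the plane. -/
def det (a b : ℝ × ℝ) : ℝ := a.1 * b.2 - a.2 * b.1

/-- The (unsigned) area of the possibly degenerate triangle with corners `a`, `b`, `c`. -/
noncomputable def triangleArea (a b c : ℝ × ℝ) : ℝ := |det (b - a) (c - a)| / 2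

/-- The boundary of the triangle with corners `a`, `b`, `c`. -/
def triangleBoundary (a b c : ℝ × ℝ) : Set (ℝ × ℝ) :=
  segment ℝ a b ∪ segment ℝ b c ∪ segment ℝ c a

/-- The directions of the vectors `a`, `b`, `c` are distinct and appear in this cyclic order when
one turns counterclockwise. The three turns `a → b → c → a` then add up to a full turn, so that at
least two of them are smaller than a half turn; in the opposite cyclic order at most one of the
three determinants is positive. -/
def IsCcw (a b c : ℝ × ℝ) : Prop :=
  (0 < det a b ∧ 0 < det b c) ∨ (0 < det b c ∧ 0 < det c a) ∨ (0 < det c a ∧ 0 < det a b)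

variable {V : Type*}

/-- The point set covered by the straight-line drawing of `G` with vertex placement `p`. -/
def support (G : SimpleGraph V) (p : V → ℝ × ℝ) : Set (ℝ × ℝ) :=
  Set.range p ∪ {x | ∃ u v, G.Adj u v ∧ x ∈ segment ℝ (p u) (p v)}

/-- The straight-line drawing of `G` with vertex placement `p` is planar: vertices are distinct
points, an edge contains no vertex besides its ends, and two distinct edges meet only in common
ends. -/
structure IsPlanar (G : SimpleGraph V) (p : V → ℝ × ℝ) : Prop where
  injective : Function.Injective p
  vertex_edge : ∀ u v w, G.Adj u v → p w ∈ segment ℝ (p u) (p v) → w = u ∨ w = v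
  edge_edge : ∀ u v x y, G.Adj u v → G.Adj x y → s(u, v) ≠ s(x, y) →
    segment ℝ (p u) (p v) ∩ segment ℝ (p x) (p y) ⊆ p '' ({u, v} ∩ {x, y})

/-- The faces of a drawing are the connected components of the complement of its support. -/
def IsFace (G : SimpleGraph V) (p : V → ℝ × ℝ) (C : Set (ℝ × ℝ)) : Prop :=
  ∃ x ∈ (support G p)ᶜ, C = connectedComponentIn (support G p)ᶜ x

/-- `C` is a face whose boundary is the drawing of the triangle `a`, `b`, `c` of `G`. -/
def IsTriangularFace (G : SimpleGraph V) (p : V → ℝ × ℝ) (C : Set (ℝ × ℝ)) (a b c : V) : Prop :=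
  IsFace G p C ∧ G.Adj a b ∧ G.Adj b c ∧ G.Adj c a ∧
    frontier C = triangleBoundary (p a) (p b) (p c)

/-- The outer (unbounded) face is bounded by the triangle `a`, `b`, `c` of `G`. -/
def IsOuterTriangle (G : SimpleGraph V) (p : V → ℝ × ℝ) (a b c : V) : Prop :=
  ∃ C, IsTriangularFace G p C a b c ∧ ¬ Bornology.IsBounded C

/-- At each vertex the incident edges leave in the same counterclockwise cyclic order in the
drawings `p` and `q`. -/
def SameRotation (G : SimpleGraph V) (p q : V → ℝ × ℝ) : Prop :=
  ∀ v a b c, G.Adj v a → G.Adj v b → G.Adj v c →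
    (IsCcw (p a - p v) (p b - p v) (p c - p v) ↔ IsCcw (q a - q v) (q b - q v) (q c - q v))

/-- Two planar drawings with triangular outer face are equivalent if the cyclic orders of the edges
at each vertex and the outer faces coincide. -/
def Equivalent (G : SimpleGraph V) (p q : V → ℝ × ℝ) : Prop :=
  SameRotation G p q ∧ ∃ a b c, IsOuterTriangle G p a b c ∧ IsOuterTriangle G q a b c

end PlaneDrawing

/-- A plane triangulation with vertex set `V`: a graph with a planar straight-line drawing each of
whose faces, including the outer one, is bounded by a triangle of the graph. -/
structure PlaneTriangulation (V : Type*) where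
  graph : SimpleGraph V
  pos : V → ℝ × ℝ
  planar : PlaneDrawing.IsPlanar graph pos
  triangular : ∀ C, PlaneDrawing.IsFace graph pos C →
    ∃ a b c, PlaneDrawing.IsTriangularFace graph pos C a b c

namespace PlaneTriangulation

variable {V : Type*}

/-- The inner faces of a plane triangulation are its bounded faces. -/
def InnerFace (T : PlaneTriangulation V) : Type :=
  {C : Set (ℝ × ℝ) // PlaneDrawing.IsFace T.graph T.pos C ∧ Bornology.IsBounded C}

/-- `D` is a crossing-free drawing equivalent to `T`: a limit of planar straight-line drawings
of the graph of `T` that are equivalent to `T`. -/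
def IsCrossingFree (T : PlaneTriangulation V) (D : V → ℝ × ℝ) : Prop :=
  ∃ q : ℕ → V → ℝ × ℝ,
    (∀ i, PlaneDrawing.IsPlanar T.graph (q i) ∧ PlaneDrawing.Equivalent T.graph T.pos (q i)) ∧
    Filter.Tendsto q Filter.atTop (𝓝 D)

/-- In the drawing `D` every inner face, drawn as the triangle on its three vertices, has the area
prescribed by `A`. -/
def HasAreas (T : PlaneTriangulation V) (A : T.InnerFace → ℝ≥0) (D : V → ℝ × ℝ) : Prop :=
  ∀ (f : T.InnerFace) (a b c : V), PlaneDrawing.IsTriangularFace T.graph T.pos f.1 a b c →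
    PlaneDrawing.triangleArea (D a) (D b) (D c) = A f

/-- Every assignment of nonnegative areas to the inner faces is realized by an equivalent
crossing-free straight-line drawing. -/
def AreaUniversal (T : PlaneTriangulation V) : Prop :=
  ∀ A : T.InnerFace → ℝ≥0, ∃ D : V → ℝ × ℝ, T.IsCrossingFree D ∧ T.HasAreas A D

end PlaneTriangulation

/-! The triangulation is an accordion: two apices `0` and `1` are joined to all vertices of a path
`4, …, l + 5`, and two adjacent vertices `2` and `3` are joined to both ends of the path, `2` also
to `0` and `3` also to `1`. The outer face is `1, 3, 4`. Three arguments make it area-universal.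

Algebra. Put the apices at `(0, 0)` and `(1, 0)`. The two triangles on a path edge have doubled
areas that add up to the difference of the heights of its ends. Hence all heights are known up to
the height `z` of the first path vertex, and a shear along the line of the apices fixes the
abscissas. Eliminating the vertices `2` and `3` from the remaining five area equations leaves one
polynomial equation in `z`. It has odd degree `2 * l + 1` and positive leading coefficient, so it
has a real root. For generic positive areas no denominator vanishes at a root, and the root gives a
placement with exactly the prescribed signed areas (`exists_insertion`, `Strip.exists_realization`).
Nothing needs to be known about the sign of `z`.

Geometry. If all inner faces have positive signed area, the placement is automatically a planar
drawing of the right type. Antisymmetric edge weights summed over all face boundaries reduce to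
their sum over the outer boundary; applied to signed crossings with a vertical ray, this shows that
a generic point lies in exactly one face if it is inside the outer triangle and in none otherwise
(`sum_ite_mem_openTriangle`). Planarity, the list of faces and the rotation at each vertex follow
(`Oriented.isPlanar`, `Oriented.eq_of_isFace`, `Oriented.equivalent`).

Limit. Arbitrary nonnegative areas are approximated by generic positive ones
(`Accordion.exists_approx`). An equiaffine normalization confines all approximating drawings to one
compact square, and a convergent subsequence has the prescribed areas in the limit
(`Oriented.areaUniversal`). -/

namespace PlaneDrawing

/-! ### Signed areas and triangles in the plane -/

/-- Twice the signed area of the triangle `a`, `b`, `c`. -/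
def turn (a b c : ℝ × ℝ) : ℝ := det (b - a) (c - a)

theorem turn_def (a b c : ℝ × ℝ) :
    turn a b c = (b.1 - a.1) * (c.2 - a.2) - (b.2 - a.2) * (c.1 - a.1) := rfl

theorem turn_rotate (a b c : ℝ × ℝ) : turn b c a = turn a b c := by
  simp only [turn_def]; ring

theorem turn_swap (a b c : ℝ × ℝ) : turn b a c = -turn a b c := by
  simp only [turn_def]; ring

@[simp] theorem turn_self_left (a b : ℝ × ℝ) : turn a b a = 0 := by
  simp only [turn_def]; ring

@[simp] theorem turn_self_right (a b : ℝ × ℝ) : turn a b b = 0 := by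
  simp only [turn_def]; ring

@[fun_prop]
theorem continuous_turn {X : Type*} [TopologicalSpace X] {f g h : X → ℝ × ℝ} (hf : Continuous f)
    (hg : Continuous g) (hh : Continuous h) : Continuous fun x => turn (f x) (g x) (h x) := by
  simp only [turn_def]; fun_prop

theorem turn_lineMap (a b x y : ℝ × ℝ) (t : ℝ) :
    turn a b (x + t • (y - x)) = (1 - t) * turn a b x + t * turn a b y := by
  simp only [turn_def, Prod.fst_add, Prod.snd_add, Prod.smul_fst, Prod.smul_snd, Prod.fst_sub,
    Prod.snd_sub, smul_eq_mul]
  ring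

theorem turn_add_turn_add_turn (a b c x : ℝ × ℝ) :
    turn a b x + turn b c x + turn c a x = turn a b c := by
  simp only [turn_def]; ring

theorem exists_of_mem_segment {a b z : ℝ × ℝ} (h : z ∈ segment ℝ a b) :
    ∃ t : ℝ, 0 ≤ t ∧ t ≤ 1 ∧ z = a + t • (b - a) := by
  rw [segment_eq_image'] at h
  obtain ⟨t, ht, rfl⟩ := h
  exact ⟨t, ht.1, ht.2, rfl⟩

theorem lineMap_mem_segment {a b : ℝ × ℝ} {t : ℝ} (h0 : 0 ≤ t) (h1 : t ≤ 1) :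
    a + t • (b - a) ∈ segment ℝ a b := by
  rw [segment_eq_image']
  exact ⟨t, ⟨h0, h1⟩, rfl⟩

theorem turn_eq_zero_of_mem_segment {a b z : ℝ × ℝ} (h : z ∈ segment ℝ a b) : turn a b z = 0 := by
  obtain ⟨t, -, -, rfl⟩ := exists_of_mem_segment h
  simp [turn_lineMap]

/-- The triangle with corners `t 0`, `t 1`, `t 2` is nondegenerate and its corners appear in
counterclockwise order. -/
def IsPositive (t : Fin 3 → ℝ × ℝ) : Prop := 0 < turn (t 0) (t 1) (t 2)

/-- The open triangle with counterclockwise corners `t 0`, `t 1`, `t 2`. -/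
def openTriangle (t : Fin 3 → ℝ × ℝ) : Set (ℝ × ℝ) := {x | ∀ k, 0 < turn (t k) (t (k + 1)) x}

/-- The closed triangle with counterclockwise corners `t 0`, `t 1`, `t 2`. -/
def closedTriangle (t : Fin 3 → ℝ × ℝ) : Set (ℝ × ℝ) := {x | ∀ k, 0 ≤ turn (t k) (t (k + 1)) x}

theorem isOpen_openTriangle (t : Fin 3 → ℝ × ℝ) : IsOpen (openTriangle t) := by
  simp only [openTriangle, Set.ofPred_forall]
  exact isOpen_iInter_of_finite fun k => isOpen_lt continuous_const (by fun_prop)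

theorem isClosed_closedTriangle (t : Fin 3 → ℝ × ℝ) : IsClosed (closedTriangle t) := by
  simp only [closedTriangle, Set.ofPred_forall]
  exact isClosed_iInter fun k => isClosed_le continuous_const (by fun_prop)

theorem openTriangle_subset_closedTriangle (t : Fin 3 → ℝ × ℝ) :
    openTriangle t ⊆ closedTriangle t := fun _ hx k => (hx k).le

theorem turn_corner (t : Fin 3 → ℝ × ℝ) (k : Fin 3) :
    turn (t k) (t (k + 1)) (t (k + 1 + 1)) = turn (t 0) (t 1) (t 2) := by
  fin_cases k
  · rfl
  · exact turn_rotate _ _ _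
  · exact (turn_rotate _ _ _).symm

theorem IsPositive.turn_pos {t : Fin 3 → ℝ × ℝ} (ht : IsPositive t) (k : Fin 3) :
    0 < turn (t k) (t (k + 1)) (t (k + 1 + 1)) := (turn_corner t k).symm ▸ ht

theorem fin_three_cases (k j : Fin 3) : j = k ∨ j = k + 1 ∨ j = k + 1 + 1 := by
  revert k j; decide

theorem fin_three_add (k : Fin 3) : k + 1 + 1 + 1 = k := by revert k; decide

theorem IsPositive.injective {t : Fin 3 → ℝ × ℝ} (ht : IsPositive t) : Function.Injective t := by
  have key : ∀ k, t k ≠ t (k + 1) := fun k h => by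
    have := ht.turn_pos k
    rw [h] at this
    simp [turn_def] at this
  intro i j h
  rcases fin_three_cases i j with rfl | rfl | rfl
  · rfl
  · exact absurd h (key i)
  · have := key (i + 1 + 1)
    rw [fin_three_add] at this
    exact absurd h.symm this

theorem corner_mem_closedTriangle {t : Fin 3 → ℝ × ℝ} (ht : IsPositive t) (k : Fin 3) :
    t k ∈ closedTriangle t := by
  intro j
  rcases fin_three_cases j k with rfl | rfl | rfl
  · simp
  · simp
  · exact (ht.turn_pos j).le

theorem segment_subset_closedTriangle {t : Fin 3 → ℝ × ℝ} {x y : ℝ × ℝ}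
    (hx : x ∈ closedTriangle t) (hy : y ∈ closedTriangle t) :
    segment ℝ x y ⊆ closedTriangle t := by
  intro z hz j
  obtain ⟨s, h0, h1, rfl⟩ := exists_of_mem_segment hz
  rw [turn_lineMap]
  exact add_nonneg (mul_nonneg (by linarith) (hx j)) (mul_nonneg h0 (hy j))

theorem lineMap_mem_openTriangle {t : Fin 3 → ℝ × ℝ} {x y : ℝ × ℝ} (hx : x ∈ closedTriangle t)
    (hy : y ∈ openTriangle t) {s : ℝ} (h0 : 0 < s) (h1 : s ≤ 1) :
    x + s • (y - x) ∈ openTriangle t := by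
  intro j
  rw [turn_lineMap]
  exact add_pos_of_nonneg_of_pos (mul_nonneg (by linarith) (hx j)) (mul_pos h0 (hy j))

theorem isPreconnected_openTriangle (t : Fin 3 → ℝ × ℝ) : IsPreconnected (openTriangle t) := by
  refine Convex.isPreconnected fun x hx y hy a b ha hb hab => ?_
  have : a • x + b • y = x + b • (y - x) := by
    rw [smul_sub, ← add_sub_assoc, add_comm x, add_sub_assoc, add_comm]
    congr 1
    rw [← eq_sub_iff_add_eq] at hab
    rw [hab, sub_smul, one_smul]
  rw [this]
  intro j
  rw [turn_lineMap]
  have h1 := hx j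
  have h2 := hy j
  rcases hb.eq_or_lt with rfl | hb
  · simpa using h1
  · exact add_pos_of_nonneg_of_pos (mul_nonneg (by linarith) h1.le) (mul_pos hb h2)

theorem openTriangle_nonempty {t : Fin 3 → ℝ × ℝ} (ht : IsPositive t) :
    (openTriangle t).Nonempty := by
  refine ⟨(1 / 3 : ℝ) • (t 0 + t 1 + t 2), fun k => ?_⟩
  have h := ht.turn_pos k
  have : turn (t k) (t (k + 1)) ((1 / 3 : ℝ) • (t 0 + t 1 + t 2)) =
      turn (t k) (t (k + 1)) (t (k + 1 + 1)) / 3 := by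
    have e : t 0 + t 1 + t 2 = t k + t (k + 1) + t (k + 1 + 1) := by
      fin_cases k
      · rfl
      · show t 0 + t 1 + t 2 = t 1 + t 2 + t 0
        abel
      · show t 0 + t 1 + t 2 = t 2 + t 0 + t 1
        abel
    rw [e]
    simp only [turn_def, Prod.fst_add, Prod.snd_add, Prod.smul_fst, Prod.smul_snd, smul_eq_mul]
    ring
  rw [this]
  positivity

theorem closure_openTriangle {t : Fin 3 → ℝ × ℝ} (ht : IsPositive t) :
    closure (openTriangle t) = closedTriangle t := by
  refine subset_antisymm
    (closure_minimal (openTriangle_subset_closedTriangle t) (isClosed_closedTriangle t)) ?_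
  intro x hx
  obtain ⟨y, hy⟩ := openTriangle_nonempty ht
  have h1 : Filter.Tendsto (fun s : ℝ => x + s • (y - x)) (𝓝[>] 0) (𝓝 x) := by
    have : Continuous fun s : ℝ => x + s • (y - x) := by fun_prop
    simpa using (this.tendsto 0).mono_left nhdsWithin_le_nhds
  refine mem_closure_of_tendsto h1 ?_
  filter_upwards [Ioc_mem_nhdsGT (zero_lt_one' ℝ)] with s hs
  exact lineMap_mem_openTriangle hx hy hs.1 hs.2

/-- The three turns, divided by `turn a b c`, are the barycentric coordinates of `x`; the one
belonging to `c` vanishes. -/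
theorem mem_segment_of_turn_eq_zero {a b c x : ℝ × ℝ} (h : 0 < turn a b c) (hab : turn a b x = 0)
    (hbc : 0 ≤ turn b c x) (hca : 0 ≤ turn c a x) : x ∈ segment ℝ a b := by
  have hs := turn_add_turn_add_turn a b c x
  have : x = a + (turn c a x / turn a b c) • (b - a) := by
    have e1 : turn a b c * (x.1 - a.1) = turn c a x * (b.1 - a.1) + turn a b x * (c.1 - a.1) := by
      simp only [turn_def]; ring
    have e2 : turn a b c * (x.2 - a.2) = turn c a x * (b.2 - a.2) + turn a b x * (c.2 - a.2) := by
      simp only [turn_def]; ring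
    ext
    · simp only [Prod.fst_add, Prod.smul_fst, Prod.fst_sub, smul_eq_mul]
      field_simp
      linear_combination e1 + (c.1 - a.1) * hab
    · simp only [Prod.snd_add, Prod.smul_snd, Prod.snd_sub, smul_eq_mul]
      field_simp
      linear_combination e2 + (c.2 - a.2) * hab
  rw [this]
  refine lineMap_mem_segment (by positivity) ?_
  rw [div_le_one h]
  linarith

theorem mem_triangleBoundary_iff {t : Fin 3 → ℝ × ℝ} {x : ℝ × ℝ} :
    x ∈ triangleBoundary (t 0) (t 1) (t 2) ↔ ∃ k, x ∈ segment ℝ (t k) (t (k + 1)) := by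
  simp only [triangleBoundary, Set.mem_union, Fin.exists_fin_succ]
  simp [or_assoc]

theorem closedTriangle_diff_openTriangle {t : Fin 3 → ℝ × ℝ} (ht : IsPositive t) :
    closedTriangle t \ openTriangle t = triangleBoundary (t 0) (t 1) (t 2) := by
  ext x
  rw [mem_triangleBoundary_iff]
  constructor
  · rintro ⟨hx, hx'⟩
    simp only [openTriangle, Set.mem_ofPred_eq, not_forall, not_lt] at hx'
    obtain ⟨k, hk⟩ := hx'
    refine ⟨k, mem_segment_of_turn_eq_zero (ht.turn_pos k) (le_antisymm hk (hx k)) (hx (k + 1)) ?_⟩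
    have := hx (k + 1 + 1)
    rwa [fin_three_add] at this
  · rintro ⟨k, hk⟩
    refine ⟨segment_subset_closedTriangle (corner_mem_closedTriangle ht k)
      (corner_mem_closedTriangle ht (k + 1)) hk, fun h => ?_⟩
    have := h k
    rw [turn_eq_zero_of_mem_segment hk] at this
    exact lt_irrefl _ this

theorem frontier_openTriangle {t : Fin 3 → ℝ × ℝ} (ht : IsPositive t) :
    frontier (openTriangle t) = triangleBoundary (t 0) (t 1) (t 2) := by
  rw [frontier, closure_openTriangle ht, (isOpen_openTriangle t).interior_eq,
    closedTriangle_diff_openTriangle ht]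

theorem interior_closedTriangle {t : Fin 3 → ℝ × ℝ} (ht : IsPositive t) :
    interior (closedTriangle t) = openTriangle t := by
  refine subset_antisymm (fun x hx k => ?_)
    (interior_maximal (openTriangle_subset_closedTriangle t) (isOpen_openTriangle t))
  have h1 : Filter.Tendsto (fun s : ℝ => x + s • (t (k + 1 + 1) - x)) (𝓝[<] 0) (𝓝 x) := by
    have : Continuous fun s : ℝ => x + s • (t (k + 1 + 1) - x) := by fun_prop
    simpa using (this.tendsto 0).mono_left nhdsWithin_le_nhds
  have h2 := h1.eventually (mem_interior_iff_mem_nhds.1 hx)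
  obtain ⟨s, hs, hs'⟩ := (h2.and self_mem_nhdsWithin).exists
  have h3 := hs k
  rw [turn_lineMap] at h3
  have h4 := ht.turn_pos k
  have hs0 : s < 0 := hs'
  nlinarith [mul_pos_of_neg_of_neg hs0 (neg_neg_of_pos h4)]

theorem frontier_compl_closedTriangle {t : Fin 3 → ℝ × ℝ} (ht : IsPositive t) :
    frontier (closedTriangle t)ᶜ = triangleBoundary (t 0) (t 1) (t 2) := by
  rw [frontier_compl, frontier, (isClosed_closedTriangle t).closure_eq, interior_closedTriangle ht,
    closedTriangle_diff_openTriangle ht]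

theorem isPreconnected_halfPlane (a b : ℝ × ℝ) : IsPreconnected {x | turn a b x < 0} := by
  refine Convex.isPreconnected fun x hx y hy s r hs hr hsr => ?_
  have : turn a b (s • x + r • y) = s * turn a b x + r * turn a b y := by
    obtain rfl : s = 1 - r := by linarith
    simp only [turn_def, Prod.fst_add, Prod.snd_add, Prod.smul_fst, Prod.smul_snd, smul_eq_mul]
    ring
  simp only [Set.mem_ofPred_eq] at *
  rw [this]
  rcases hs.eq_or_lt with rfl | hs
  · obtain rfl : r = 1 := by linarith
    simpa using hy
  · nlinarith [mul_pos hs (neg_pos.2 hx), mul_nonneg hr (neg_pos.2 hy).le]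

/-- The complement is a union of three open half-planes, two of which overlap behind each corner. -/
theorem isPreconnected_compl_closedTriangle {t : Fin 3 → ℝ × ℝ} (ht : IsPositive t) :
    IsPreconnected (closedTriangle t)ᶜ := by
  have e : (closedTriangle t)ᶜ = {x | turn (t 0) (t 1) x < 0} ∪ {x | turn (t 1) (t 2) x < 0} ∪
      {x | turn (t 2) (t 0) x < 0} := by
    ext x
    simp only [closedTriangle, Set.mem_compl_iff, Set.mem_ofPred_eq, Fin.forall_fin_succ,
      Set.mem_union]
    simp
    grind
  have key : ∀ k, ∃ x, turn (t k) (t (k + 1)) x < 0 ∧ turn (t (k + 1)) (t (k + 1 + 1)) x < 0 := by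
    intro k
    have h := ht.turn_pos k
    -- The corner `t (k + 1)`, pushed away from the midpoint of the opposite side.
    refine ⟨t (k + 1) + (t (k + 1) + t (k + 1) - t k - t (k + 1 + 1)), ?_, ?_⟩ <;>
    · simp only [turn_def, Prod.fst_add, Prod.snd_add, Prod.fst_sub, Prod.snd_sub] at h ⊢
      nlinarith
  rw [e]
  obtain ⟨x, hx⟩ := key 0
  obtain ⟨y, hy⟩ := key 1
  exact ((isPreconnected_halfPlane _ _).union x hx.1 hx.2 (isPreconnected_halfPlane _ _)).union y
    (Or.inr hy.1) hy.2 (isPreconnected_halfPlane _ _)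

theorem closedTriangle_subset_Icc {t : Fin 3 → ℝ × ℝ} (ht : IsPositive t) {m M : ℝ × ℝ}
    (h : ∀ k, t k ∈ Set.Icc m M) : closedTriangle t ⊆ Set.Icc m M := by
  intro x hx
  have h0 := hx 0
  have h1 := hx 1
  have h2 := hx 2
  have hs := turn_add_turn_add_turn (t 0) (t 1) (t 2) x
  simp only [zero_add, Fin.isValue, show (1 : Fin 3) + 1 = 2 from rfl,
    show (2 : Fin 3) + 1 = 0 from rfl] at h0 h1 h2
  have e1 : turn (t 0) (t 1) (t 2) * x.1 = turn (t 1) (t 2) x * (t 0).1 + turn (t 2) (t 0) x * (t 1).1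
      + turn (t 0) (t 1) x * (t 2).1 := by simp only [turn_def]; ring
  have e2 : turn (t 0) (t 1) (t 2) * x.2 = turn (t 1) (t 2) x * (t 0).2 + turn (t 2) (t 0) x * (t 1).2
      + turn (t 0) (t 1) x * (t 2).2 := by simp only [turn_def]; ring
  have b0 := h 0
  have b1 := h 1
  have b2 := h 2
  simp only [Set.mem_Icc, Prod.le_def] at b0 b1 b2 ⊢
  have hp : 0 < turn (t 0) (t 1) (t 2) := ht
  generalize turn (t 0) (t 1) (t 2) = s at *
  generalize turn (t 1) (t 2) x = u at *
  generalize turn (t 2) (t 0) x = v at *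
  generalize turn (t 0) (t 1) x = w at *
  subst hs
  refine ⟨⟨?_, ?_⟩, ?_, ?_⟩ <;> refine le_of_mul_le_mul_left ?_ hp <;>
  simp only [e1, e2, add_mul] <;>
  nlinarith [mul_le_mul_of_nonneg_left b0.1.1 h1, mul_le_mul_of_nonneg_left b0.1.2 h1,
    mul_le_mul_of_nonneg_left b0.2.1 h1, mul_le_mul_of_nonneg_left b0.2.2 h1,
    mul_le_mul_of_nonneg_left b1.1.1 h2, mul_le_mul_of_nonneg_left b1.1.2 h2,
    mul_le_mul_of_nonneg_left b1.2.1 h2, mul_le_mul_of_nonneg_left b1.2.2 h2,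
    mul_le_mul_of_nonneg_left b2.1.1 h0, mul_le_mul_of_nonneg_left b2.1.2 h0,
    mul_le_mul_of_nonneg_left b2.2.1 h0, mul_le_mul_of_nonneg_left b2.2.2 h0]

theorem isBounded_closedTriangle {t : Fin 3 → ℝ × ℝ} (ht : IsPositive t) :
    Bornology.IsBounded (closedTriangle t) := by
  have hb : Bornology.IsBounded (Set.range t) := (Set.finite_range t).isBounded
  obtain ⟨m, hm⟩ := hb.bddBelow
  obtain ⟨M, hM⟩ := hb.bddAbove
  exact (Metric.isBounded_Icc m M).subset (closedTriangle_subset_Icc ht fun k =>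
    ⟨hm (Set.mem_range_self k), hM (Set.mem_range_self k)⟩)

theorem not_isBounded_compl_closedTriangle {t : Fin 3 → ℝ × ℝ} (ht : IsPositive t) :
    ¬ Bornology.IsBounded (closedTriangle t)ᶜ := by
  intro h
  have := (isBounded_closedTriangle ht).union h
  rw [Set.union_compl_self] at this
  exact NormedSpace.unbounded_univ ℝ (ℝ × ℝ) this

theorem dense_turn_ne_zero {a b : ℝ × ℝ} (h : a ≠ b) : Dense {x | turn a b x ≠ 0} := by
  intro x
  by_cases hx : turn a b x = 0
  -- The direction is the normal of the line, so any small positive step leaves it.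
  · have h1 : Filter.Tendsto (fun s : ℝ => x + s • (a.2 - b.2, b.1 - a.1)) (𝓝[>] 0) (𝓝 x) := by
      have : Continuous fun s : ℝ => x + s • (a.2 - b.2, b.1 - a.1) := by fun_prop
      simpa using (this.tendsto 0).mono_left nhdsWithin_le_nhds
    refine mem_closure_of_tendsto h1 ?_
    filter_upwards [self_mem_nhdsWithin] with s hs
    have e : turn a b (x + s • (a.2 - b.2, b.1 - a.1)) =
        turn a b x + s * ((b.1 - a.1) ^ 2 + (b.2 - a.2) ^ 2) := by
      simp only [turn_def, Prod.fst_add, Prod.snd_add, Prod.smul_mk, smul_eq_mul]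
      ring
    have hs0 : 0 < s := hs
    show turn a b (x + s • (a.2 - b.2, b.1 - a.1)) ≠ 0
    rw [e, hx, zero_add]
    refine mul_ne_zero hs0.ne' fun h0 => h ?_
    have h1 : b.1 - a.1 = 0 := by nlinarith [sq_nonneg (b.1 - a.1), sq_nonneg (b.2 - a.2)]
    have h2 : b.2 - a.2 = 0 := by nlinarith [sq_nonneg (b.1 - a.1), sq_nonneg (b.2 - a.2)]
    ext <;> linarith
  · exact subset_closure hx

/-! ### Crossing numbers of a vertical ray -/

/-- The signed number of crossings of the edge from `a` to `b` with the upward ray from `x`. -/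
noncomputable def crossing (x a b : ℝ × ℝ) : ℝ :=
  if b.1 ≤ x.1 ∧ x.1 < a.1 ∧ 0 < turn a b x then 1
  else if a.1 ≤ x.1 ∧ x.1 < b.1 ∧ turn a b x < 0 then -1 else 0

theorem crossing_swap (x a b : ℝ × ℝ) : crossing x a b = -crossing x b a := by
  unfold crossing
  rw [turn_swap b a x]
  simp only [Left.neg_pos_iff, Left.neg_neg_iff]
  grind

-- The winding number of a triangle. The half-open condition on abscissas in `crossing` counts a
-- corner lying on the ray consistently for its two edges. What remains is a case distinction by
-- signs, whose impossible cases are excluded by the barycentric identity `e1`.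
open Classical in
theorem crossing_add_crossing_add_crossing {a b c x : ℝ × ℝ} (h : 0 < turn a b c)
    (hab : turn a b x ≠ 0) (hbc : turn b c x ≠ 0) (hca : turn c a x ≠ 0) :
    crossing x a b + crossing x b c + crossing x c a =
      if 0 < turn a b x ∧ 0 < turn b c x ∧ 0 < turn c a x then 1 else 0 := by
  have hs := turn_add_turn_add_turn a b c x
  have e1 : turn b c x * (a.1 - x.1) + turn c a x * (b.1 - x.1)
      + turn a b x * (c.1 - x.1) = 0 := by simp only [turn_def]; ring
  have e2 : a.1 - x.1 = 0 → b.1 - x.1 = 0 → c.1 - x.1 = 0 → turn a b c = 0 := by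
    intro h1 h2 h3
    rw [turn_def]
    linear_combination (c.2 - a.2) * (h2 - h1) - (b.2 - a.2) * (h3 - h1)
  unfold crossing
  generalize turn a b c = s at *
  generalize turn b c x = u at *
  generalize turn c a x = v at *
  generalize turn a b x = w at *
  obtain ⟨A, hA⟩ : ∃ A, A = a.1 - x.1 := ⟨_, rfl⟩
  obtain ⟨B, hB⟩ : ∃ B, B = b.1 - x.1 := ⟨_, rfl⟩
  obtain ⟨C, hC⟩ : ∃ C, C = c.1 - x.1 := ⟨_, rfl⟩
  rw [← hA, ← hB, ← hC] at e1 e2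
  have sA : a.1 ≤ x.1 ↔ A ≤ 0 := by rw [hA]; constructor <;> intro <;> linarith
  have sB : b.1 ≤ x.1 ↔ B ≤ 0 := by rw [hB]; constructor <;> intro <;> linarith
  have sC : c.1 ≤ x.1 ↔ C ≤ 0 := by rw [hC]; constructor <;> intro <;> linarith
  have tA : x.1 < a.1 ↔ 0 < A := by rw [hA]; constructor <;> intro <;> linarith
  have tB : x.1 < b.1 ↔ 0 < B := by rw [hB]; constructor <;> intro <;> linarith
  have tC : x.1 < c.1 ↔ 0 < C := by rw [hC]; constructor <;> intro <;> linarith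
  simp only [sA, sB, sC, tA, tB, tC]
  clear hA hB hC sA sB sC tA tB tC
  have sgn : ∀ y : ℝ, (y ≤ 0 ∧ ¬ 0 < y) ∨ (0 < y ∧ ¬ y ≤ 0) := fun y =>
    (le_or_gt y 0).imp (fun h => ⟨h, h.not_gt⟩) fun h => ⟨h, h.not_ge⟩
  have absurd_pos : 0 < u → 0 < v → 0 < w → A ≤ 0 → B ≤ 0 → C ≤ 0 → False := by
    intro hu hv hw hA hB hC
    have h1 := mul_nonpos_of_nonneg_of_nonpos hu.le hA
    have h2 := mul_nonpos_of_nonneg_of_nonpos hv.le hB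
    have h3 := mul_nonpos_of_nonneg_of_nonpos hw.le hC
    have hA0 : A = 0 := (mul_eq_zero.1 (show u * A = 0 by linarith)).resolve_left hu.ne'
    have hB0 : B = 0 := (mul_eq_zero.1 (show v * B = 0 by linarith)).resolve_left hv.ne'
    have hC0 : C = 0 := (mul_eq_zero.1 (show w * C = 0 by linarith)).resolve_left hw.ne'
    exact h.ne' (e2 hA0 hB0 hC0)
  rcases lt_or_gt_of_ne hab with hw | hw <;> rcases lt_or_gt_of_ne hbc with hu | hu <;>
  rcases lt_or_gt_of_ne hca with hv | hv <;> rcases sgn A with ⟨hA, hA'⟩ | ⟨hA, hA'⟩ <;>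
  rcases sgn B with ⟨hB, hB'⟩ | ⟨hB, hB'⟩ <;> rcases sgn C with ⟨hC, hC'⟩ | ⟨hC, hC'⟩ <;>
  simp only [hw, hu, hv, hA, hB, hC, hw.not_gt, hu.not_gt, hv.not_gt, hA', hB',
    hC', and_true, and_false, if_true, if_false] <;>
  norm_num <;> first | exact absurd_pos hu hv hw hA hB hC | nlinarith

end PlaneDrawing

open PlaneDrawing

/-! ### Triangulated disks and their positively oriented placements -/

/-- The combinatorial data of a triangulated disk whose boundary is a triangle: `corner f` lists the
corners of the face `f` counterclockwise and `outer` the corners of the disk. Boundary sums of antisymmetric edge weights cancel along inner edges, and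
the faces at each vertex form a fan in which the neighbors `u 0, …, u d` follow each other
counterclockwise. -/
structure DiskTriangulation (V F : Type*) [Fintype F] where
  corner : F → Fin 3 → V
  outer : Fin 3 → V
  sum_corner : ∀ w : V → V → ℝ, (∀ u v, w u v = -w v u) →
    ∑ f, ∑ k, w (corner f k) (corner f (k + 1)) = ∑ k, w (outer k) (outer (k + 1))
  opposite : ∀ f k, (∃ g j, corner g j = corner f (k + 1) ∧ corner g (j + 1) = corner f k) ∨
    ∃ j, outer j = corner f k ∧ outer (j + 1) = corner f (k + 1)
  outer_edge : ∀ k, ∃ f j, corner f j = outer k ∧ corner f (j + 1) = outer (k + 1)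
  exists_corner : ∀ v, ∃ f k, corner f k = v
  fan : ∀ v, ∃ (d : ℕ) (u : ℕ → V),
    (∀ i < d, ∃ f k, corner f k = v ∧ corner f (k + 1) = u i ∧ corner f (k + 1 + 1) = u (i + 1)) ∧
    (∀ i ≤ d, 0 < i → u i ≠ u 0) ∧
    ∀ f k, corner f k = v →
      (∃ i ≤ d, u i = corner f (k + 1)) ∧ ∃ i ≤ d, u i = corner f (k + 1 + 1)

namespace DiskTriangulation

variable {V F : Type*} [Fintype F] (D : DiskTriangulation V F)

/-- The graph formed by the edges of the faces. -/
def graph : SimpleGraph V where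
  Adj u v := u ≠ v ∧ ∃ f i j, D.corner f i = u ∧ D.corner f j = v
  symm := ⟨fun _ _ ⟨h, f, i, j, hi, hj⟩ => ⟨h.symm, f, j, i, hj, hi⟩⟩
  loopless := ⟨fun _ h => h.1 rfl⟩

/-- The corners of the face `f` in the placement `p`. -/
def face (p : V → ℝ × ℝ) (f : F) : Fin 3 → ℝ × ℝ := fun k => p (D.corner f k)

/-- The corners of the disk in the placement `p`. -/
def hull (p : V → ℝ × ℝ) : Fin 3 → ℝ × ℝ := fun k => p (D.outer k)

/-- All faces are nondegenerate and counterclockwise in the placement `p`. -/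
def Oriented (p : V → ℝ × ℝ) : Prop := ∀ f, IsPositive (D.face p f)

theorem sum_det (t : Fin 3 → ℝ × ℝ) :
    ∑ k, PlaneDrawing.det (t k) (t (k + 1)) = turn (t 0) (t 1) (t 2) := by
  simp only [Fin.sum_univ_three, turn_def, PlaneDrawing.det, zero_add,
    show (1 : Fin 3) + 1 = 2 from rfl, show (2 : Fin 3) + 1 = 0 from rfl]
  ring

theorem sum_turn_face (p : V → ℝ × ℝ) :
    ∑ f, turn (D.face p f 0) (D.face p f 1) (D.face p f 2) =
      turn (D.hull p 0) (D.hull p 1) (D.hull p 2) := by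
  simp only [← sum_det]
  exact D.sum_corner (fun u v => PlaneDrawing.det (p u) (p v)) fun u v => by
    simp only [PlaneDrawing.det]; ring

variable {D} {p : V → ℝ × ℝ}

namespace Oriented

variable (hp : D.Oriented p)
include hp

theorem hull_isPositive : IsPositive (D.hull p) := by
  obtain ⟨f, -⟩ := D.outer_edge 0
  have := D.sum_turn_face p
  rw [IsPositive, ← this]
  exact Finset.sum_pos (fun f _ => hp f) ⟨f, Finset.mem_univ f⟩

theorem corner_injective (f : F) : Function.Injective (D.corner f) := fun i j h =>
  (hp f).injective (by simp only [face, h])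

end Oriented

/-- The points that lie on no line through an edge. -/
def offLines (D : DiskTriangulation V F) (p : V → ℝ × ℝ) : Set (ℝ × ℝ) :=
  ⋂ i : F × Fin 3, {x | turn (D.face p i.1 i.2) (D.face p i.1 (i.2 + 1)) x ≠ 0}

theorem dense_offLines (hp : D.Oriented p) : Dense (D.offLines p) := by
  refine dense_iInter_of_isOpen (fun i => isOpen_ne_fun (by fun_prop) continuous_const) fun i =>
    dense_turn_ne_zero fun h => ?_
  have := (hp i.1).injective h
  revert this
  generalize i.2 = k
  revert k
  decide

theorem exists_mem_offLines (hp : D.Oriented p) {U : Set (ℝ × ℝ)} (hU : IsOpen U)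
    (hne : U.Nonempty) : ∃ x ∈ U, x ∈ D.offLines p := by
  obtain ⟨x, hx, hx'⟩ := (dense_offLines hp).inter_open_nonempty U hU hne
  exact ⟨x, hx, hx'⟩

open Classical in
theorem sum_crossing {t : Fin 3 → ℝ × ℝ} (ht : IsPositive t) {x : ℝ × ℝ}
    (hx : ∀ k, turn (t k) (t (k + 1)) x ≠ 0) :
    ∑ k, crossing x (t k) (t (k + 1)) = if x ∈ openTriangle t then 1 else 0 := by
  have h := crossing_add_crossing_add_crossing ht (hx 0) (hx 1) (hx 2)
  simp only [Fin.sum_univ_three]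
  refine h.trans (if_congr ?_ rfl rfl)
  simp [openTriangle, Fin.forall_fin_succ]

-- Both sides are total crossing numbers of the ray from `x`: the crossings of inner edges cancel by
-- `sum_corner`. This is the degree argument behind all later results: the faces tile the outer
-- triangle without overlap.
open Classical in
theorem sum_ite_mem_openTriangle (hp : D.Oriented p) {x : ℝ × ℝ} (hx : x ∈ D.offLines p) :
    (∑ f, if x ∈ openTriangle (D.face p f) then (1 : ℝ) else 0) =
      if x ∈ openTriangle (D.hull p) then 1 else 0 := by
  simp only [offLines, Set.mem_iInter, Set.mem_ofPred_eq, Prod.forall] at hx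
  rw [← sum_crossing hp.hull_isPositive]
  · rw [← show _ = ∑ k, crossing x (D.hull p k) (D.hull p (k + 1)) from
      D.sum_corner (fun u v => crossing x (p u) (p v)) fun u v => crossing_swap _ _ _]
    exact Finset.sum_congr rfl fun f _ => (sum_crossing (hp f) (hx f)).symm
  · intro k
    obtain ⟨f, j, h1, h2⟩ := D.outer_edge k
    have := hx f j
    simpa only [face, hull, h1, h2] using this

namespace Oriented

variable (hp : D.Oriented p)
include hp

/-- Two overlapping open faces would share a point off all lines, which would be counted at least
twice. -/
theorem eq_of_mem_openTriangle {f g : F} {x : ℝ × ℝ} (hf : x ∈ openTriangle (D.face p f))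
    (hg : x ∈ openTriangle (D.face p g)) : f = g := by
  classical
  by_contra hne
  obtain ⟨y, ⟨hyf, hyg⟩, hy⟩ := exists_mem_offLines hp
    ((isOpen_openTriangle (D.face p f)).inter (isOpen_openTriangle (D.face p g))) ⟨x, hf, hg⟩
  have h := sum_ite_mem_openTriangle hp hy
  have h1 : ∑ k ∈ {f, g}, (if y ∈ openTriangle (D.face p k) then (1 : ℝ) else 0) ≤
      ∑ k, if y ∈ openTriangle (D.face p k) then (1 : ℝ) else 0 :=
    Finset.sum_le_sum_of_subset_of_nonneg (Finset.subset_univ _) fun k _ _ => by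
      split_ifs <;> norm_num
  rw [Finset.sum_pair hne, if_pos hyf, if_pos hyg, h] at h1
  split_ifs at h1 <;> norm_num at h1

theorem eq_of_mem_closedTriangle {f g : F} {x : ℝ × ℝ} (hf : x ∈ openTriangle (D.face p f))
    (hg : x ∈ closedTriangle (D.face p g)) : f = g := by
  rw [← closure_openTriangle (hp g)] at hg
  obtain ⟨y, hy, hy'⟩ := mem_closure_iff.1 hg _ (isOpen_openTriangle (D.face p f)) hf
  exact hp.eq_of_mem_openTriangle hy hy'

theorem closedTriangle_subset (f : F) :
    closedTriangle (D.face p f) ⊆ closedTriangle (D.hull p) := by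
  classical
  have h : openTriangle (D.face p f) ∩ D.offLines p ⊆ closedTriangle (D.hull p) := by
    rintro x ⟨hx, hx'⟩
    have h := sum_ite_mem_openTriangle hp hx'
    have h1 := Finset.single_le_sum (f := fun k =>
      if x ∈ openTriangle (D.face p k) then (1 : ℝ) else 0)
      (fun k _ => by split_ifs <;> norm_num) (Finset.mem_univ f)
    rw [h] at h1
    simp only [hx, if_true] at h1
    split_ifs at h1 with h2
    · exact openTriangle_subset_closedTriangle _ h2
    · norm_num at h1
  rw [← closure_openTriangle (hp f)]
  refine closure_minimal (fun x hx => ?_) (isClosed_closedTriangle _)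
  have := (dense_offLines hp).open_subset_closure_inter (isOpen_openTriangle (D.face p f)) hx
  exact closure_minimal h (isClosed_closedTriangle _) this

theorem openTriangle_subset (f : F) : openTriangle (D.face p f) ⊆ openTriangle (D.hull p) := by
  rw [← interior_closedTriangle (hp f), ← interior_closedTriangle hp.hull_isPositive]
  exact interior_mono (hp.closedTriangle_subset f)

theorem exists_mem_closedTriangle {x : ℝ × ℝ} (hx : x ∈ closedTriangle (D.hull p)) :
    ∃ f, x ∈ closedTriangle (D.face p f) := by
  classical
  have h : openTriangle (D.hull p) ∩ D.offLines p ⊆ ⋃ f, closedTriangle (D.face p f) := by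
    rintro y ⟨hy, hy'⟩
    have h := sum_ite_mem_openTriangle hp hy'
    rw [if_pos hy] at h
    obtain ⟨f, -, hf⟩ := Finset.exists_ne_zero_of_sum_ne_zero (h.trans_ne one_ne_zero)
    simp only [ne_eq, ite_eq_right_iff, one_ne_zero, imp_false, not_not] at hf
    exact Set.mem_iUnion.2 ⟨f, openTriangle_subset_closedTriangle _ hf⟩
  have hc : IsClosed (⋃ f, closedTriangle (D.face p f)) :=
    isClosed_iUnion_of_finite fun f => isClosed_closedTriangle _
  rw [← closure_openTriangle hp.hull_isPositive] at hx
  refine Set.mem_iUnion.1 (closure_minimal (fun y hy => ?_) hc hx)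
  exact closure_minimal h hc
    ((dense_offLines hp).open_subset_closure_inter (isOpen_openTriangle (D.hull p)) hy)

theorem closedTriangle_face_pos {f : F} {k : Fin 3} {s : ℝ} (h0 : 0 < s) (h1 : s < 1) :
    0 < turn (D.face p f (k + 1)) (D.face p f (k + 1 + 1))
        (D.face p f k + s • (D.face p f (k + 1) - D.face p f k)) ∧
      0 < turn (D.face p f (k + 1 + 1)) (D.face p f k)
        (D.face p f k + s • (D.face p f (k + 1) - D.face p f k)) := by
  have h := (hp f).turn_pos k
  have h' : 0 < turn (D.face p f (k + 1 + 1)) (D.face p f k) (D.face p f (k + 1)) := by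
    rwa [← turn_rotate]
  rw [turn_lineMap, turn_lineMap, turn_rotate (D.face p f k)]
  simp only [turn_self_left, turn_self_right, mul_zero, add_zero, zero_add]
  exact ⟨mul_pos (by linarith) h, mul_pos h0 h'⟩

/-- A face that contains an inner point of an edge contains both ends of this edge as corners. -/
theorem exists_corner_eq_of_mem {f g : F} {k : Fin 3} {s : ℝ} (h0 : 0 < s) (h1 : s < 1)
    (hz : D.face p f k + s • (D.face p f (k + 1) - D.face p f k) ∈ closedTriangle (D.face p g)) :
    f = g ∨ ∃ j, D.corner g j = D.corner f (k + 1) ∧ D.corner g (j + 1) = D.corner f k := by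
  set z := D.face p f k + s • (D.face p f (k + 1) - D.face p f k) with hzdef
  have hmem : ∀ (f' : F) (k' : Fin 3) (x : ℝ × ℝ),
      0 < turn (D.face p f' k') (D.face p f' (k' + 1)) x →
      0 < turn (D.face p f' (k' + 1)) (D.face p f' (k' + 1 + 1)) x →
      0 < turn (D.face p f' (k' + 1 + 1)) (D.face p f' k') x → x ∈ openTriangle (D.face p f') := by
    intro f' k' x a b c j
    rcases fin_three_cases k' j with rfl | rfl | rfl
    · exact a
    · exact b
    · rwa [fin_three_add]
  have key : ∀ (f' : F) (k' : Fin 3) (s' : ℝ), 0 < s' → s' < 1 →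
      z = D.face p f' k' + s' • (D.face p f' (k' + 1) - D.face p f' k') →
      ∀ᶠ x in 𝓝 z, 0 < turn (D.face p f' k') (D.face p f' (k' + 1)) x →
        x ∈ openTriangle (D.face p f') := by
    intro f' k' s' h0 h1 e
    obtain ⟨ha, hb⟩ := hp.closedTriangle_face_pos (f := f') (k := k') h0 h1
    rw [← e] at ha hb
    have ha' := (isOpen_lt continuous_const (by fun_prop : Continuous fun x =>
      turn (D.face p f' (k' + 1)) (D.face p f' (k' + 1 + 1)) x)).mem_nhds ha
    have hb' := (isOpen_lt continuous_const (by fun_prop : Continuous fun x =>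
      turn (D.face p f' (k' + 1 + 1)) (D.face p f' k') x)).mem_nhds hb
    filter_upwards [ha', hb'] with x h1 h2 h3
    exact hmem f' k' x h3 h1 h2
  -- Near `z` there are points of the open face `g` strictly on one side of the edge. Each side is
  -- locally filled by a known face or is exterior, and open faces do not overlap, so `g` is
  -- identified.
  have hfar : ∀ U ∈ 𝓝 z, ∃ x ∈ U, x ∈ openTriangle (D.face p g) ∧
      turn (D.face p f k) (D.face p f (k + 1)) x ≠ 0 := by
    intro U hU
    rw [← closure_openTriangle (hp g)] at hz
    obtain ⟨y, hy, hy'⟩ := mem_closure_iff.1 hz _ isOpen_interior (mem_interior_iff_mem_nhds.2 hU)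
    obtain ⟨x, ⟨hx1, hx2⟩, hx⟩ := exists_mem_offLines hp
      (isOpen_interior.inter (isOpen_openTriangle (D.face p g))) ⟨y, hy, hy'⟩
    exact ⟨x, interior_subset hx1, hx2, Set.mem_iInter.1 hx (f, k)⟩
  have hf := key f k s h0 h1 rfl
  rcases D.opposite f k with ⟨g', j, hj, hj'⟩ | ⟨j, hj, hj'⟩
  · have e1 : D.face p g' j = D.face p f (k + 1) := congrArg p hj
    have e2 : D.face p g' (j + 1) = D.face p f k := congrArg p hj'
    have hg' := key g' j (1 - s) (by linarith) (by linarith) (by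
      rw [e1, e2, hzdef]
      module)
    obtain ⟨x, ⟨hx1, hx2⟩, hx3, hx4⟩ := hfar _ (hf.and hg')
    rw [e1, e2, turn_swap] at hx2
    rcases lt_or_gt_of_ne hx4 with h | h
    · obtain rfl := hp.eq_of_mem_openTriangle hx3 (hx2 (by linarith))
      exact Or.inr ⟨j, hj, hj'⟩
    · exact Or.inl (hp.eq_of_mem_openTriangle (hx1 h) hx3)
  · obtain ⟨x, hx1, hx3, hx4⟩ := hfar _ hf
    have h := hp.openTriangle_subset g hx3 j
    simp only [hull, hj, hj'] at h
    exact Or.inl (hp.eq_of_mem_openTriangle (hx1 h) hx3)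

end Oriented

end DiskTriangulation

/-! ### The star of a vertex -/

namespace PlaneDrawing

theorem exists_ray_of_turn_eq_zero_left {z a b x : ℝ × ℝ} (h : 0 < turn z a b)
    (h0 : turn z a x = 0) (h1 : 0 < turn b z x) : ∃ s : ℝ, 0 < s ∧ x = z + s • (a - z) := by
  refine ⟨turn b z x / turn z a b, div_pos h1 h, ?_⟩
  have e1 : turn z a b * (x.1 - z.1) = turn b z x * (a.1 - z.1) + turn z a x * (b.1 - z.1) := by
    simp only [turn_def]; ring
  have e2 : turn z a b * (x.2 - z.2) = turn b z x * (a.2 - z.2) + turn z a x * (b.2 - z.2) := by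
    simp only [turn_def]; ring
  rw [h0, zero_mul, add_zero] at e1 e2
  ext
  · simp only [Prod.fst_add, Prod.smul_fst, Prod.fst_sub, smul_eq_mul]
    field_simp
    linear_combination e1
  · simp only [Prod.snd_add, Prod.smul_snd, Prod.snd_sub, smul_eq_mul]
    field_simp
    linear_combination e2

theorem exists_ray_of_turn_eq_zero_right {z a b x : ℝ × ℝ} (h : 0 < turn z a b)
    (h0 : turn b z x = 0) (h1 : 0 < turn z a x) : ∃ s : ℝ, 0 < s ∧ x = z + s • (b - z) := by
  refine ⟨turn z a x / turn z a b, div_pos h1 h, ?_⟩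
  have e1 : turn z a b * (x.1 - z.1) = turn b z x * (a.1 - z.1) + turn z a x * (b.1 - z.1) := by
    simp only [turn_def]; ring
  have e2 : turn z a b * (x.2 - z.2) = turn b z x * (a.2 - z.2) + turn z a x * (b.2 - z.2) := by
    simp only [turn_def]; ring
  rw [h0, zero_mul, zero_add] at e1 e2
  ext
  · simp only [Prod.fst_add, Prod.smul_fst, Prod.fst_sub, smul_eq_mul]
    field_simp
    linear_combination e1
  · simp only [Prod.snd_add, Prod.smul_snd, Prod.snd_sub, smul_eq_mul]
    field_simp
    linear_combination e2

theorem eq_of_turn_eq_zero {z a b x : ℝ × ℝ} (h : turn z a b ≠ 0)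
    (h0 : turn z a x = 0) (h1 : turn b z x = 0) : x = z := by
  have e1 : turn z a b * (x.1 - z.1) = turn b z x * (a.1 - z.1) + turn z a x * (b.1 - z.1) := by
    simp only [turn_def]; ring
  have e2 : turn z a b * (x.2 - z.2) = turn b z x * (a.2 - z.2) + turn z a x * (b.2 - z.2) := by
    simp only [turn_def]; ring
  rw [h0, h1, zero_mul, zero_mul, zero_add, mul_eq_zero, or_iff_right h] at e1 e2
  ext <;> linarith

end PlaneDrawing

theorem fin_three_ne_add (k : Fin 3) : k ≠ k + 1 := by revert k; decide

namespace DiskTriangulation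

variable {V F : Type*} [Fintype F] {D : DiskTriangulation V F} {p : V → ℝ × ℝ}

/-- The union of the cones at the vertex `u` that are spanned by the faces at `u` and, if `u` is a
corner of the disk, the outside of the disk. -/
def starCone (D : DiskTriangulation V F) (p : V → ℝ × ℝ) (u : V) : Set (ℝ × ℝ) :=
  {x | (∃ f k, D.corner f k = u ∧ 0 ≤ turn (D.face p f k) (D.face p f (k + 1)) x ∧
      0 ≤ turn (D.face p f (k + 1 + 1)) (D.face p f k) x) ∨
    ∃ j, D.outer j = u ∧ (turn (D.hull p j) (D.hull p (j + 1)) x ≤ 0 ∨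
      turn (D.hull p (j + 1 + 1)) (D.hull p j) x ≤ 0)}

theorem isClosed_starCone (u : V) : IsClosed (D.starCone p u) := by
  have e : D.starCone p u =
      (⋃ (f) (k) (_ : D.corner f k = u), {x | 0 ≤ turn (D.face p f k) (D.face p f (k + 1)) x} ∩
        {x | 0 ≤ turn (D.face p f (k + 1 + 1)) (D.face p f k) x}) ∪
      ⋃ (j) (_ : D.outer j = u), {x | turn (D.hull p j) (D.hull p (j + 1)) x ≤ 0} ∪
        {x | turn (D.hull p (j + 1 + 1)) (D.hull p j) x ≤ 0} := by
    ext x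
    simp only [starCone, Set.mem_ofPred_eq, Set.mem_union, Set.mem_iUnion, Set.mem_inter_iff,
      exists_prop]
  rw [e]
  refine (isClosed_iUnion_of_finite fun f => isClosed_iUnion_of_finite fun k =>
    isClosed_iUnion_of_finite fun _ => ?_).union
    (isClosed_iUnion_of_finite fun j => isClosed_iUnion_of_finite fun _ => ?_)
  · exact (isClosed_le continuous_const (by fun_prop)).inter
      (isClosed_le continuous_const (by fun_prop))
  · exact (isClosed_le (by fun_prop) continuous_const).union
      (isClosed_le (by fun_prop) continuous_const)

theorem eventually_turn_pos {a b z : ℝ × ℝ} (h : 0 < turn a b z) :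
    ∀ᶠ x in 𝓝 z, 0 < turn a b x :=
  (isOpen_lt continuous_const (by fun_prop : Continuous fun x => turn a b x)).mem_nhds h

theorem eventually_turn_neg {a b z : ℝ × ℝ} (h : turn a b z < 0) :
    ∀ᶠ x in 𝓝 z, turn a b x < 0 :=
  (isOpen_lt (by fun_prop : Continuous fun x => turn a b x) continuous_const).mem_nhds h

namespace Oriented

variable (hp : D.Oriented p)
include hp

/-- Each side of an edge ray at `u` belongs to the cone of a face or to the exterior, so the star
has no boundary along the ray. -/
theorem starCone_mem_nhds_of_ray {u v : V} {s : ℝ} (hs : 0 < s)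
    (hl : (∃ f k, D.corner f k = u ∧ D.corner f (k + 1) = v) ∨
      ∃ j, D.outer j = v ∧ D.outer (j + 1) = u)
    (hr : (∃ f k, D.corner f k = v ∧ D.corner f (k + 1) = u) ∨
      ∃ j, D.outer j = u ∧ D.outer (j + 1) = v) :
    D.starCone p u ∈ 𝓝 (p u + s • (p v - p u)) := by
  have left : ∀ᶠ x in 𝓝 (p u + s • (p v - p u)), 0 ≤ turn (p u) (p v) x → x ∈ D.starCone p u := by
    rcases hl with ⟨f, k, hu, hv⟩ | ⟨j, hv, hu⟩
    · have h : 0 < turn (D.face p f (k + 1 + 1)) (p u) (p u + s • (p v - p u)) := by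
        have := (hp f).turn_pos k
        rw [← turn_rotate, ← turn_rotate] at this
        simp only [face, hu, hv, turn_lineMap] at this ⊢
        simpa using mul_pos hs this
      filter_upwards [eventually_turn_pos h] with x hx h0
      refine Or.inl ⟨f, k, hu, ?_, ?_⟩
      · simpa only [face, hu, hv] using h0
      · simpa only [face, hu] using hx.le
    · refine Filter.Eventually.of_forall fun x h0 => Or.inr ⟨j + 1, hu, Or.inr ?_⟩
      rw [fin_three_add]
      simp only [hull, hu, hv]
      rw [turn_swap]
      linarith
  have right : ∀ᶠ x in 𝓝 (p u + s • (p v - p u)), turn (p u) (p v) x ≤ 0 → x ∈ D.starCone p u := by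
    rcases hr with ⟨f, k, hv, hu⟩ | ⟨j, hu, hv⟩
    · have h : 0 < turn (p u) (D.face p f (k + 1 + 1)) (p u + s • (p v - p u)) := by
        have := (hp f).turn_pos k
        simp only [face, hu, hv, turn_lineMap] at this ⊢
        rw [← turn_rotate] at this
        simpa using mul_pos hs this
      filter_upwards [eventually_turn_pos h] with x hx h0
      refine Or.inl ⟨f, k + 1, hu, ?_, ?_⟩
      · simpa only [face, hu] using hx.le
      · rw [fin_three_add]
        simp only [face, hu, hv]
        rw [turn_swap]
        linarith
    · refine Filter.Eventually.of_forall fun x h0 => Or.inr ⟨j, hu, Or.inl ?_⟩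
      simpa only [hull, hu, hv] using h0
  filter_upwards [left, right] with x h1 h2
  exact (le_total 0 (turn (p u) (p v) x)).elim h1 h2

theorem starCone_mem_nhds {u : V} {x : ℝ × ℝ} (hx : x ∈ D.starCone p u) (hne : x ≠ p u) :
    D.starCone p u ∈ 𝓝 x := by
  rcases hx with ⟨f, k, rfl, h1, h2⟩ | ⟨j, rfl, h⟩
  · have hf := (hp f).turn_pos k
    rcases h1.eq_or_lt with h1 | h1
    · have h2 : 0 < turn (D.face p f (k + 1 + 1)) (D.face p f k) x :=
        h2.lt_of_ne fun h => hne (eq_of_turn_eq_zero hf.ne' h1.symm h.symm)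
      obtain ⟨s, hs, rfl⟩ := exists_ray_of_turn_eq_zero_left hf h1.symm h2
      exact hp.starCone_mem_nhds_of_ray hs (Or.inl ⟨f, k, rfl, rfl⟩) (D.opposite f k)
    rcases h2.eq_or_lt with h2 | h2
    · obtain ⟨s, hs, rfl⟩ := exists_ray_of_turn_eq_zero_right hf h2.symm h1
      have e := fin_three_add k
      have h := D.opposite f (k + 1 + 1)
      rw [e] at h
      exact hp.starCone_mem_nhds_of_ray hs h (Or.inl ⟨f, k + 1 + 1, rfl, by rw [e]⟩)
    · filter_upwards [eventually_turn_pos h1, eventually_turn_pos h2] with y h1 h2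
      exact Or.inl ⟨f, k, rfl, h1.le, h2.le⟩
  · have ho := hp.hull_isPositive.turn_pos j
    by_cases h1 : turn (D.hull p j) (D.hull p (j + 1)) x < 0
    · filter_upwards [eventually_turn_neg h1] with y h1
      exact Or.inr ⟨j, rfl, Or.inl h1.le⟩
    by_cases h2 : turn (D.hull p (j + 1 + 1)) (D.hull p j) x < 0
    · filter_upwards [eventually_turn_neg h2] with y h2
      exact Or.inr ⟨j, rfl, Or.inr h2.le⟩
    rw [not_lt] at h1 h2
    rcases h1.eq_or_lt with h1 | h1
    · have h2 : 0 < turn (D.hull p (j + 1 + 1)) (D.hull p j) x :=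
        h2.lt_of_ne fun h => hne (eq_of_turn_eq_zero ho.ne' h1.symm h.symm)
      obtain ⟨s, hs, rfl⟩ := exists_ray_of_turn_eq_zero_left ho h1.symm h2
      exact hp.starCone_mem_nhds_of_ray hs (Or.inl (D.outer_edge j)) (Or.inr ⟨j, rfl, rfl⟩)
    · have h2 : 0 = turn (D.hull p (j + 1 + 1)) (D.hull p j) x :=
        h2.eq_of_not_lt fun h2 => (h.elim h1.not_ge h2.not_ge)
      obtain ⟨s, hs, rfl⟩ := exists_ray_of_turn_eq_zero_right ho h2.symm h1
      have e := fin_three_add j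
      have h := D.outer_edge (j + 1 + 1)
      rw [e] at h
      exact hp.starCone_mem_nhds_of_ray hs (Or.inr ⟨j + 1 + 1, rfl, by rw [e]⟩) (Or.inl h)

/-- The star is closed and, away from `p u`, also open. The punctured plane is connected. -/
theorem compl_singleton_subset_starCone (u : V) : {p u}ᶜ ⊆ D.starCone p u := by
  have hc : IsPreconnected ({p u}ᶜ : Set (ℝ × ℝ)) :=
    (isConnected_compl_singleton_of_one_lt_rank (by simp [one_add_one_eq_two]) _).isPreconnected
  refine (hc.subset_of_closure_inter_subset isOpen_interior ?_ ?_).trans interior_subset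
  · obtain ⟨f, k, hk⟩ := D.exists_corner u
    obtain ⟨x, hx⟩ := openTriangle_nonempty (hp f)
    refine ⟨x, fun h => ?_, ?_⟩
    · have := hx k
      rw [Set.mem_singleton_iff.1 h, ← hk] at this
      simp [face] at this
    · refine mem_interior.2 ⟨_, fun y hy => ?_, isOpen_openTriangle _, hx⟩
      refine Or.inl ⟨f, k, hk, (hy k).le, ?_⟩
      have := hy (k + 1 + 1)
      rw [fin_three_add] at this
      exact this.le
  · rintro x ⟨hx, hx'⟩
    have := closure_minimal interior_subset (isClosed_starCone u) hx
    exact mem_interior_iff_mem_nhds.2 (hp.starCone_mem_nhds this hx')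

/-- A face contains only those vertices that are its corners. -/
theorem exists_corner_eq_of_vertex_mem {u : V} {g : F} (hu : p u ∈ closedTriangle (D.face p g)) :
    ∃ k, D.corner g k = u := by
  -- Close to `p u` the side of a face opposite to `u` imposes no condition, so there the cones at
  -- `u` coincide with the faces at `u`.
  have h1 : ∀ᶠ x in 𝓝 (p u), ∀ (f : F) (k : Fin 3), D.corner f k = u →
      0 < turn (D.face p f (k + 1)) (D.face p f (k + 1 + 1)) x := by
    refine Filter.eventually_all.2 fun f => Filter.eventually_all.2 fun k => ?_
    by_cases h : D.corner f k = u
    · have := (hp f).turn_pos k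
      rw [← turn_rotate] at this
      filter_upwards [eventually_turn_pos (z := p u) (by simpa only [face, h] using this)]
        with x hx _ using hx
    · exact Filter.Eventually.of_forall fun x h' => absurd h' h
  rw [← closure_openTriangle (hp g)] at hu
  obtain ⟨x, hx, hxg⟩ := mem_closure_iff.1 hu _ isOpen_interior (mem_interior_iff_mem_nhds.2 h1)
  replace hx := interior_subset hx
  by_cases hxu : x = p u
  · obtain ⟨f, k, hk⟩ := D.exists_corner u
    have h2 := corner_mem_closedTriangle (hp f) k
    rw [show D.face p f k = x by simp only [face, hk, hxu]] at h2
    rw [hp.eq_of_mem_closedTriangle hxg h2]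
    exact ⟨k, hk⟩
  rcases hp.compl_singleton_subset_starCone u hxu with ⟨f, k, hk, ha, hb⟩ | ⟨j, hj, hj'⟩
  · refine ⟨k, ?_⟩
    rwa [hp.eq_of_mem_closedTriangle hxg (g := f)]
    intro i
    rcases fin_three_cases k i with rfl | rfl | rfl
    · exact ha
    · exact (hx f k hk).le
    · rwa [fin_three_add]
  · have h3 := hp.openTriangle_subset g hxg
    have h4 := h3 (j + 1 + 1)
    rw [fin_three_add] at h4
    exact absurd (h3 j) (hj'.resolve_right h4.not_ge).not_gt

theorem position_injective : Function.Injective p := by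
  intro u w h
  obtain ⟨f, k, hk⟩ := D.exists_corner w
  have h1 := corner_mem_closedTriangle (hp f) k
  rw [show D.face p f k = p u by simp only [face, hk, h]] at h1
  obtain ⟨j, hj⟩ := hp.exists_corner_eq_of_vertex_mem h1
  have : j = k := (hp f).injective (by simp only [face, hj, hk, h])
  rw [← hj, this, hk]

end Oriented

/-! ### Planarity and the faces of the drawing -/

theorem exists_edge_of_adj {u v : V} (h : D.graph.Adj u v) :
    ∃ f k, (D.corner f k = u ∧ D.corner f (k + 1) = v) ∨
      (D.corner f k = v ∧ D.corner f (k + 1) = u) := by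
  obtain ⟨hne, f, i, j, rfl, rfl⟩ := h
  rcases fin_three_cases i j with rfl | rfl | rfl
  · exact absurd rfl hne
  · exact ⟨f, i, Or.inl ⟨rfl, rfl⟩⟩
  · exact ⟨f, i + 1 + 1, Or.inr ⟨rfl, by rw [fin_three_add]⟩⟩

namespace Oriented

variable (hp : D.Oriented p)
include hp

theorem corner_adj (f : F) {i j : Fin 3} (h : i ≠ j) :
    D.graph.Adj (D.corner f i) (D.corner f j) :=
  ⟨fun e => h (hp.corner_injective f e), f, i, j, rfl, rfl⟩

theorem outer_adj (k : Fin 3) : D.graph.Adj (D.outer k) (D.outer (k + 1)) := by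
  obtain ⟨f, j, h1, h2⟩ := D.outer_edge k
  rw [← h1, ← h2]
  exact hp.corner_adj f (fin_three_ne_add j)

/-- The ends of an edge with an inner point in the face `g` are corners of `g`. -/
theorem exists_corners_of_inner_point_mem {u v : V} (huv : D.graph.Adj u v) {g : F} {z : ℝ × ℝ}
    (hz : z ∈ segment ℝ (p u) (p v)) (hu : z ≠ p u) (hv : z ≠ p v)
    (hg : z ∈ closedTriangle (D.face p g)) :
    ∃ k, ((D.corner g k = u ∧ D.corner g (k + 1) = v) ∨
      (D.corner g k = v ∧ D.corner g (k + 1) = u)) ∧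
      0 < turn (D.face p g (k + 1)) (D.face p g (k + 1 + 1)) z ∧
      0 < turn (D.face p g (k + 1 + 1)) (D.face p g k) z := by
  obtain ⟨f, k, h⟩ := exists_edge_of_adj huv
  wlog h' : D.corner f k = u ∧ D.corner f (k + 1) = v generalizing u v
  · have := this huv.symm (segment_symm ℝ (p u) (p v) ▸ hz) hv hu h.symm (h.resolve_left h')
    simpa only [or_comm] using this
  clear h
  obtain ⟨s, h0, h1, rfl⟩ := exists_of_mem_segment hz
  have h0 : 0 < s := h0.lt_of_ne (by rintro rfl; simp at hu)
  have h1 : s < 1 := h1.lt_of_ne (by rintro rfl; simp at hv)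
  rw [← h'.1, ← h'.2] at hg
  rcases hp.exists_corner_eq_of_mem h0 h1 hg with rfl | ⟨j, hj1, hj2⟩
  · refine ⟨k, Or.inl h', ?_⟩
    rw [← h'.1, ← h'.2]
    exact hp.closedTriangle_face_pos h0 h1
  · refine ⟨j, Or.inr ⟨hj1.trans h'.2, hj2.trans h'.1⟩, ?_⟩
    have e : p u + s • (p v - p u) =
        D.face p g j + (1 - s) • (D.face p g (j + 1) - D.face p g j) := by
      simp only [face, hj1, hj2, h'.1, h'.2]
      module
    rw [e]
    exact hp.closedTriangle_face_pos (by linarith) (by linarith)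

theorem segment_subset_closedTriangle_of_adj {u v : V} (h : D.graph.Adj u v) :
    ∃ f, (∃ i, D.corner f i = u) ∧ (∃ j, D.corner f j = v) ∧
      segment ℝ (p u) (p v) ⊆ closedTriangle (D.face p f) := by
  obtain ⟨-, f, i, j, rfl, rfl⟩ := h
  exact ⟨f, ⟨i, rfl⟩, ⟨j, rfl⟩, segment_subset_closedTriangle (corner_mem_closedTriangle (hp f) i)
    (corner_mem_closedTriangle (hp f) j)⟩

/-- The edge `xy` is a side of some face `g`. Since `g` contains an inner point of `uv`, that edge
is also a side of `g`, and the point is strictly inside the other two sides of `g`. -/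
theorem eq_of_inner_point_mem {u v x y : V} (huv : D.graph.Adj u v) (hxy : D.graph.Adj x y)
    {z : ℝ × ℝ} (hz : z ∈ segment ℝ (p u) (p v)) (hu : z ≠ p u) (hv : z ≠ p v)
    (hz' : z ∈ segment ℝ (p x) (p y)) : s(u, v) = s(x, y) := by
  obtain ⟨g, ⟨i, hi⟩, ⟨j, hj⟩, hsub⟩ := hp.segment_subset_closedTriangle_of_adj hxy
  obtain ⟨k, hk, h1, h2⟩ := hp.exists_corners_of_inner_point_mem huv hz hu hv (hsub hz')
  have hne : i ≠ j := fun h => hxy.1 (by rw [← hi, ← hj, h])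
  have a1 : ∀ z ∈ segment ℝ (D.face p g (k + 1)) (D.face p g (k + 1 + 1)), ¬ 0 <
      turn (D.face p g (k + 1)) (D.face p g (k + 1 + 1)) z := fun z hz h =>
    h.ne' (turn_eq_zero_of_mem_segment hz)
  have a2 : ∀ z ∈ segment ℝ (D.face p g (k + 1 + 1)) (D.face p g k), ¬ 0 <
      turn (D.face p g (k + 1 + 1)) (D.face p g k) z := fun z hz h =>
    h.ne' (turn_eq_zero_of_mem_segment hz)
  rw [← hi, ← hj] at hz'
  have hz'' := hz'
  rw [segment_symm] at hz''
  rw [Sym2.eq_iff]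
  have hik := fin_three_cases k i
  have hjk := fin_three_cases k j
  rcases hik with rfl | rfl | rfl <;> rcases hjk with rfl | rfl | rfl
  · exact absurd rfl hne
  · rw [hi, hj] at hk
    rcases hk with ⟨rfl, rfl⟩ | ⟨rfl, rfl⟩ <;> simp
  · exact absurd h2 (a2 z hz'')
  · rw [hi, hj] at hk
    rcases hk with ⟨rfl, rfl⟩ | ⟨rfl, rfl⟩ <;> simp
  · exact absurd rfl hne
  · exact absurd h1 (a1 z hz')
  · exact absurd h2 (a2 z hz')
  · exact absurd h1 (a1 z hz'')
  · exact absurd rfl hne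

theorem isPlanar : IsPlanar D.graph p where
  injective := hp.position_injective
  vertex_edge u v w huv hw := by
    by_contra! h
    obtain ⟨f, k, hk⟩ := D.exists_corner w
    have h1 := corner_mem_closedTriangle (hp f) k
    rw [show D.face p f k = p w by simp only [face, hk]] at h1
    obtain ⟨j, hj, h2, h3⟩ := hp.exists_corners_of_inner_point_mem huv hw
      (fun e => h.1 (hp.position_injective e)) (fun e => h.2 (hp.position_injective e)) h1
    have : k = j + 1 + 1 := by
      rcases fin_three_cases j k with rfl | rfl | rfl
      · rw [hk] at hj
        exact (hj.elim (fun e => h.1 e.1) fun e => h.2 e.1).elim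
      · rw [hk] at hj
        exact (hj.elim (fun e => h.2 e.2) fun e => h.1 e.2).elim
      · rfl
    rw [show p w = D.face p f (j + 1 + 1) by rw [← this]; simp only [face, hk]] at h2
    simp at h2
  edge_edge u v x y huv hxy hne z := by
    rintro ⟨hz, hz'⟩
    have h1 : z = p u ∨ z = p v := by
      by_contra! h
      exact hne (hp.eq_of_inner_point_mem huv hxy hz h.1 h.2 hz')
    have h2 : z = p x ∨ z = p y := by
      by_contra! h
      exact hne.symm (hp.eq_of_inner_point_mem hxy huv hz' h.1 h.2 hz)
    have inj := hp.position_injective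
    rcases h1 with rfl | rfl <;> rcases h2 with h2 | h2 <;> obtain rfl := inj h2 <;>
    exact ⟨_, by simp, rfl⟩

theorem support_subset : support D.graph p ⊆ ⋃ f, closedTriangle (D.face p f) := by
  rintro x (⟨v, rfl⟩ | ⟨u, v, huv, hx⟩)
  · obtain ⟨f, k, rfl⟩ := D.exists_corner v
    exact Set.mem_iUnion.2 ⟨f, corner_mem_closedTriangle (hp f) k⟩
  · obtain ⟨f, -, -, hf⟩ := hp.segment_subset_closedTriangle_of_adj huv
    exact Set.mem_iUnion.2 ⟨f, hf hx⟩

theorem triangleBoundary_subset_support (f : F) :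
    triangleBoundary (D.face p f 0) (D.face p f 1) (D.face p f 2) ⊆ support D.graph p := by
  intro x hx
  obtain ⟨k, hk⟩ := mem_triangleBoundary_iff.1 hx
  exact Or.inr ⟨_, _, hp.corner_adj f (fin_three_ne_add k), hk⟩

theorem disjoint_openTriangle_support (f : F) :
    Disjoint (openTriangle (D.face p f)) (support D.graph p) := by
  rw [Set.disjoint_left]
  rintro x hx (⟨v, rfl⟩ | ⟨u, v, huv, hxs⟩)
  · obtain ⟨g, k, rfl⟩ := D.exists_corner v
    have h1 : D.face p g k ∈ openTriangle (D.face p f) := hx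
    obtain rfl := hp.eq_of_mem_closedTriangle h1 (corner_mem_closedTriangle (hp g) k)
    have := h1 k
    simp at this
  · obtain ⟨g, k, hk⟩ := exists_edge_of_adj huv
    have hxs : x ∈ segment ℝ (D.face p g k) (D.face p g (k + 1)) := by
      rcases hk with ⟨h1, h2⟩ | ⟨h1, h2⟩
      · simpa only [face, h1, h2] using hxs
      · simpa only [face, h1, h2, segment_symm ℝ (p v)] using hxs
    obtain rfl := hp.eq_of_mem_closedTriangle hx (segment_subset_closedTriangle
      (corner_mem_closedTriangle (hp g) k) (corner_mem_closedTriangle (hp g) (k + 1)) hxs)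
    have := hx k
    rw [turn_eq_zero_of_mem_segment hxs] at this
    exact lt_irrefl _ this

theorem disjoint_compl_support : Disjoint (closedTriangle (D.hull p))ᶜ (support D.graph p) := by
  rw [Set.disjoint_left]
  intro x hx hxs
  obtain ⟨f, hf⟩ := Set.mem_iUnion.1 (hp.support_subset hxs)
  exact hx (hp.closedTriangle_subset f hf)

theorem compl_support : (support D.graph p)ᶜ =
    (⋃ f, openTriangle (D.face p f)) ∪ (closedTriangle (D.hull p))ᶜ := by
  ext x
  constructor
  · intro hx
    by_cases h : x ∈ closedTriangle (D.hull p)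
    · obtain ⟨f, hf⟩ := hp.exists_mem_closedTriangle h
      refine Or.inl (Set.mem_iUnion.2 ⟨f, ?_⟩)
      by_contra hx'
      exact hx (hp.triangleBoundary_subset_support f
        (closedTriangle_diff_openTriangle (hp f) ▸ ⟨hf, hx'⟩))
    · exact Or.inr h
  · rintro (hx | hx) hs
    · obtain ⟨f, hf⟩ := Set.mem_iUnion.1 hx
      exact Set.disjoint_left.1 (hp.disjoint_openTriangle_support f) hf hs
    · exact Set.disjoint_left.1 hp.disjoint_compl_support hx hs

-- A preconnected subset that is relatively clopen and nonempty is a component.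
omit hp in
theorem connectedComponentIn_eq_of_isOpen {s U : Set (ℝ × ℝ)} {x : ℝ × ℝ} (hU : IsOpen U)
    (hc : IsPreconnected U) (hUs : U ⊆ s) (hdiff : IsOpen (s \ U)) (hx : x ∈ U) :
    connectedComponentIn s x = U := by
  refine subset_antisymm ?_ (hc.subset_connectedComponentIn hx hUs)
  have h1 : connectedComponentIn s x ⊆ U ∪ s \ U := by
    rw [Set.union_sdiff_cancel hUs]
    exact connectedComponentIn_subset s x
  exact isPreconnected_connectedComponentIn.subset_left_of_subset_union hU hdiff
    Set.disjoint_sdiff_right h1 ⟨x, mem_connectedComponentIn (hUs hx), hx⟩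

theorem disjoint_openTriangle_compl (f : F) :
    Disjoint (openTriangle (D.face p f)) (closedTriangle (D.hull p))ᶜ := by
  rw [Set.disjoint_left]
  exact fun x hx hx' => hx' (hp.closedTriangle_subset f (openTriangle_subset_closedTriangle _ hx))

theorem connectedComponentIn_openTriangle {f : F} {x : ℝ × ℝ}
    (hx : x ∈ openTriangle (D.face p f)) :
    connectedComponentIn (support D.graph p)ᶜ x = openTriangle (D.face p f) := by
  refine connectedComponentIn_eq_of_isOpen (isOpen_openTriangle _) (isPreconnected_openTriangle _)
    (Set.disjoint_left.1 (hp.disjoint_openTriangle_support f)) ?_ hx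
  have e : (support D.graph p)ᶜ \ openTriangle (D.face p f) =
      (⋃ (g) (_ : g ≠ f), openTriangle (D.face p g)) ∪ (closedTriangle (D.hull p))ᶜ := by
    rw [hp.compl_support]
    ext y
    simp only [Set.mem_sdiff, Set.mem_union, Set.mem_iUnion, exists_prop]
    constructor
    · rintro ⟨⟨g, hg⟩ | h, hf⟩
      · exact Or.inl ⟨g, fun h => hf (h ▸ hg), hg⟩
      · exact Or.inr h
    · rintro (⟨g, hne, hg⟩ | h)
      · exact ⟨Or.inl ⟨g, hg⟩, fun hf => hne (hp.eq_of_mem_openTriangle hg hf)⟩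
      · exact ⟨Or.inr h, fun hf => Set.disjoint_left.1 (hp.disjoint_openTriangle_compl f) hf h⟩
  rw [e]
  exact (isOpen_iUnion fun g => isOpen_iUnion fun _ => isOpen_openTriangle _).union
    (isClosed_closedTriangle _).isOpen_compl

theorem connectedComponentIn_compl {x : ℝ × ℝ} (hx : x ∈ (closedTriangle (D.hull p))ᶜ) :
    connectedComponentIn (support D.graph p)ᶜ x = (closedTriangle (D.hull p))ᶜ := by
  refine connectedComponentIn_eq_of_isOpen (isClosed_closedTriangle _).isOpen_compl
    (isPreconnected_compl_closedTriangle hp.hull_isPositive)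
    (Set.disjoint_left.1 hp.disjoint_compl_support) ?_ hx
  have e : (support D.graph p)ᶜ \ (closedTriangle (D.hull p))ᶜ =
      ⋃ g, openTriangle (D.face p g) := by
    rw [hp.compl_support, Set.union_sdiff_right, sdiff_eq_left]
    exact Set.disjoint_iUnion_left.2 hp.disjoint_openTriangle_compl
  rw [e]
  exact isOpen_iUnion fun g => isOpen_openTriangle _

theorem isFace_openTriangle (f : F) : IsFace D.graph p (openTriangle (D.face p f)) := by
  obtain ⟨x, hx⟩ := openTriangle_nonempty (hp f)
  exact ⟨x, Set.disjoint_left.1 (hp.disjoint_openTriangle_support f) hx,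
    (hp.connectedComponentIn_openTriangle hx).symm⟩

theorem isFace_compl : IsFace D.graph p (closedTriangle (D.hull p))ᶜ := by
  obtain ⟨x, hx⟩ : ((closedTriangle (D.hull p))ᶜ).Nonempty := by
    rw [Set.nonempty_iff_ne_empty]
    intro h
    apply not_isBounded_compl_closedTriangle hp.hull_isPositive
    simp [h]
  exact ⟨x, Set.disjoint_left.1 hp.disjoint_compl_support hx,
    (hp.connectedComponentIn_compl hx).symm⟩

theorem eq_of_isFace {C : Set (ℝ × ℝ)} (hC : IsFace D.graph p C) :
    (∃ f, C = openTriangle (D.face p f)) ∨ C = (closedTriangle (D.hull p))ᶜ := by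
  obtain ⟨x, hx, rfl⟩ := hC
  rw [hp.compl_support] at hx
  rcases hx with hx | hx
  · obtain ⟨f, hf⟩ := Set.mem_iUnion.1 hx
    exact Or.inl ⟨f, hp.connectedComponentIn_openTriangle hf⟩
  · exact Or.inr (hp.connectedComponentIn_compl hx)

theorem isTriangularFace_openTriangle (f : F) : IsTriangularFace D.graph p
    (openTriangle (D.face p f)) (D.corner f 0) (D.corner f 1) (D.corner f 2) :=
  ⟨hp.isFace_openTriangle f, hp.corner_adj f (by decide), hp.corner_adj f (by decide),
    hp.corner_adj f (by decide), frontier_openTriangle (hp f)⟩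

theorem isTriangularFace_compl : IsTriangularFace D.graph p
    (closedTriangle (D.hull p))ᶜ (D.outer 0) (D.outer 1) (D.outer 2) :=
  ⟨hp.isFace_compl, hp.outer_adj 0, hp.outer_adj 1, hp.outer_adj 2,
    frontier_compl_closedTriangle hp.hull_isPositive⟩

theorem isOuterTriangle : IsOuterTriangle D.graph p (D.outer 0) (D.outer 1) (D.outer 2) :=
  ⟨_, hp.isTriangularFace_compl, not_isBounded_compl_closedTriangle hp.hull_isPositive⟩

end Oriented

end DiskTriangulation

/-! ### Rotation at a vertex and equivalence of drawings -/

namespace PlaneDrawing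

theorem IsCcw.rotate {a b c : ℝ × ℝ} (h : IsCcw a b c) : IsCcw b c a := by
  unfold IsCcw at *
  tauto

theorem det_swap (a b : ℝ × ℝ) : det b a = -det a b := by
  simp only [det]; ring

theorem IsCcw.not_swap {a b c : ℝ × ℝ} (h : IsCcw a b c) : ¬ IsCcw a c b := by
  unfold IsCcw at *
  rw [det_swap c a, det_swap b c, det_swap a b]
  grind

theorem IsCcw.ne {a b c : ℝ × ℝ} (h : IsCcw a b c) : a ≠ b ∧ b ≠ c ∧ a ≠ c := by
  have key : ∀ {a b c : ℝ × ℝ}, IsCcw a b c → a ≠ b := by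
    rintro a b c h rfl
    unfold IsCcw at h
    have h1 : det a a = 0 := by simp only [det]; ring
    have h2 := det_swap a c
    grind
  exact ⟨key h, key h.rotate, (key h.rotate.rotate).symm⟩

/-- The Plücker relation `e` between the six determinants decides the signs, separately for each
sign of `det a c`. -/
theorem IsCcw.trans {a b c d : ℝ × ℝ} (h : IsCcw a b c) (h' : IsCcw a c d) : IsCcw a b d := by
  unfold IsCcw at *
  have e : det a b * det c d - det a c * det b d + det a d * det b c = 0 := by
    simp only [det]; ring
  rw [det_swap a c] at h
  rw [det_swap a d] at h' ⊢
  generalize det a b = x1 at *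
  generalize det b c = x2 at *
  generalize det a c = x3 at *
  generalize det c d = x4 at *
  generalize det a d = x5 at *
  generalize det b d = x6 at *
  simp only [Left.neg_pos_iff] at *
  rcases lt_trichotomy x3 0 with h3 | h3 | h3
  · have h4 : 0 < x4 ∧ x5 < 0 := by grind
    by_cases h1 : 0 < x1
    · exact Or.inr (Or.inr ⟨h4.2, h1⟩)
    · have h2 : 0 < x2 := by grind
      refine Or.inr (Or.inl ⟨?_, h4.2⟩)
      by_contra h6
      nlinarith [mul_nonneg (neg_nonneg.2 h3.le) (neg_nonneg.2 (not_lt.1 h6)),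
        mul_pos (neg_pos.2 h4.2) h2, mul_nonneg (neg_nonneg.2 (not_lt.1 h1)) h4.1.le]
  · exact Or.inr (Or.inr (by grind))
  · have h1 : 0 < x1 ∧ 0 < x2 := by grind
    by_cases h5 : x5 < 0
    · exact Or.inr (Or.inr ⟨h5, h1.1⟩)
    · have h4 : 0 < x4 := by grind
      refine Or.inl ⟨h1.1, ?_⟩
      by_contra h6
      nlinarith [mul_nonneg h3.le (neg_nonneg.2 (not_lt.1 h6)), mul_pos h1.1 h4,
        mul_nonneg (not_lt.1 h5) h1.2.le]

theorem lineMap_ne {a b : ℝ × ℝ} (h : a ≠ b) {s : ℝ} (h0 : 0 < s) (h1 : s < 1) :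
    a + s • (b - a) ≠ a ∧ a + s • (b - a) ≠ b := by
  constructor <;> intro e
  · rw [add_eq_left, smul_eq_zero, sub_eq_zero] at e
    exact e.elim h0.ne' fun e => h e.symm
  · have h3 : (1 - s) • (b - a) = b - (a + s • (b - a)) := by module
    rw [e, sub_self, smul_eq_zero, sub_eq_zero, sub_eq_zero] at h3
    exact h3.elim h1.ne' fun e => h e.symm

theorem triangleArea_eq (t : Fin 3 → ℝ × ℝ) {i j k : Fin 3} (hij : i ≠ j) (hjk : j ≠ k)
    (hik : i ≠ k) : triangleArea (t i) (t j) (t k) = |turn (t 0) (t 1) (t 2)| / 2 := by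
  have key : ∀ a b c : ℝ × ℝ, triangleArea b c a = triangleArea a b c := fun a b c =>
    congrArg (|·| / 2) (turn_rotate a b c)
  have key' : ∀ a b c : ℝ × ℝ, triangleArea b a c = triangleArea a b c := fun a b c => by
    show |turn b a c| / 2 = |turn a b c| / 2
    rw [turn_swap, abs_neg]
  show triangleArea (t i) (t j) (t k) = triangleArea (t 0) (t 1) (t 2)
  fin_cases i <;> fin_cases j <;> fin_cases k <;> simp at hij hjk hik ⊢
  · rw [key, key']
  · rw [key']
  · rw [key]
  · rw [← key]
  · rw [← key, key']

end PlaneDrawing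

namespace DiskTriangulation

variable {V F : Type*} [Fintype F] {D : DiskTriangulation V F} {p q : V → ℝ × ℝ}

namespace Oriented

/-- Otherwise `p a` lies in the closed cone of `f` at this corner. Then the edge towards `a` starts
inside `f`, which makes `a` a corner of `f`. -/
theorem isCcw_of_face (hp : D.Oriented p) {f : F} {k : Fin 3} {a : V}
    (ha : D.graph.Adj (D.corner f k) a) (h1 : a ≠ D.corner f (k + 1))
    (h2 : a ≠ D.corner f (k + 1 + 1)) :
    IsCcw (p a - D.face p f k) (D.face p f (k + 1) - D.face p f k)
      (D.face p f (k + 1 + 1) - D.face p f k) := by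
  have hf := (hp f).turn_pos k
  by_contra hcon
  have ha1 : 0 ≤ turn (D.face p f k) (D.face p f (k + 1)) (p a) := by
    by_contra h
    refine hcon (Or.inl ⟨?_, hf⟩)
    rw [det_swap]
    exact neg_pos.2 (not_le.1 h)
  have ha2 : 0 ≤ turn (D.face p f (k + 1 + 1)) (D.face p f k) (p a) := by
    by_contra h
    refine hcon (Or.inr (Or.inl ⟨hf, ?_⟩))
    rw [turn_swap] at h
    have h : 0 < turn (D.face p f k) (D.face p f (k + 1 + 1)) (p a) := by linarith
    exact h
  have hf' := hf
  rw [← turn_rotate] at hf'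
  have hev : ∀ᶠ s : ℝ in 𝓝[>] 0, 0 < turn (D.face p f (k + 1)) (D.face p f (k + 1 + 1))
      (D.face p f k + s • (p a - D.face p f k)) := by
    have hc : Continuous fun s : ℝ => turn (D.face p f (k + 1)) (D.face p f (k + 1 + 1))
      (D.face p f k + s • (p a - D.face p f k)) := by fun_prop
    refine (hc.tendsto 0).mono_left nhdsWithin_le_nhds |>.eventually (lt_mem_nhds ?_)
    simpa using hf'
  obtain ⟨s, hs, hs0, hs1⟩ := (hev.and (Ioo_mem_nhdsGT one_pos)).exists
  obtain ⟨hz1, hz2⟩ := lineMap_ne (a := p (D.corner f k)) (b := p a)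
    (fun h => ha.1 (hp.position_injective h)) hs0 hs1
  have hz : D.face p f k + s • (p a - D.face p f k) ∈ closedTriangle (D.face p f) := by
    intro j
    rcases fin_three_cases k j with rfl | rfl | rfl
    · rw [turn_lineMap]
      simpa using mul_nonneg hs0.le ha1
    · exact hs.le
    · rw [fin_three_add, turn_lineMap]
      simpa using mul_nonneg hs0.le ha2
  obtain ⟨j, hj, -⟩ := hp.exists_corners_of_inner_point_mem ha
    (lineMap_mem_segment hs0.le hs1.le) hz1 hz2 hz
  have : ∃ i, D.corner f i = a := by
    rcases hj with h | h
    exacts [⟨_, h.2⟩, ⟨_, h.1⟩]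
  obtain ⟨i, rfl⟩ := this
  rcases fin_three_cases k i with rfl | rfl | rfl
  exacts [ha.1 rfl, h1 rfl, h2 rfl]

/-- The fan does not return to `u 0`, so `isCcw_of_face` applies to `u 0` and each later face. These
triples chain together by `IsCcw.trans`, and two triples through `u 0` give one that avoids it. -/
theorem isCcw_of_fan (hp : D.Oriented p) {v : V} {d : ℕ} {u : ℕ → V}
    (h1 : ∀ i < d, ∃ f k, D.corner f k = v ∧ D.corner f (k + 1) = u i ∧
      D.corner f (k + 1 + 1) = u (i + 1))
    (h2 : ∀ i ≤ d, 0 < i → u i ≠ u 0) {i j k : ℕ} (hij : i < j) (hjk : j < k) (hk : k ≤ d) :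
    IsCcw (p (u i) - p v) (p (u j) - p v) (p (u k) - p v) := by
  have base : ∀ j k, 0 < j → j < k → k ≤ d →
      IsCcw (p (u 0) - p v) (p (u j) - p v) (p (u k) - p v) := by
    intro j k hj hjk hk
    have step : ∀ k, 0 < k → k < d →
        IsCcw (p (u 0) - p v) (p (u k) - p v) (p (u (k + 1)) - p v) := by
      intro k hk hkd
      obtain ⟨f, i, rfl, hf1, hf2⟩ := h1 k hkd
      obtain ⟨g, l, hg, hg1, -⟩ := h1 0 (by omega)
      have hadj := hp.corner_adj g (fin_three_ne_add l)
      rw [hg, hg1] at hadj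
      have := hp.isCcw_of_face hadj (hf1 ▸ (h2 k hkd.le hk).symm)
        (hf2 ▸ (h2 (k + 1) hkd k.succ_pos).symm)
      simpa only [face, hf1, hf2] using this
    induction k, hjk using Nat.le_induction with
    | base => exact step j hj hk
    | succ k hjk ih =>
      have hjk : j < k := hjk
      exact (ih (by omega)).trans (step k (by omega) (by omega))
  rcases Nat.eq_zero_or_pos i with rfl | hi
  · exact base j k hij hjk hk
  · have a1 := base i j hi hij (by omega)
    have a2 := base j k (by omega) hjk hk
    exact (a2.rotate.trans a1.rotate.rotate).rotate.rotate

/-- In both placements the cyclic order is that of the indices in the fan, which is purely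
combinatorial. -/
theorem isCcw_imp (hp : D.Oriented p) (hq : D.Oriented q) {v a b c : V} (ha : D.graph.Adj v a)
    (hb : D.graph.Adj v b) (hc : D.graph.Adj v c)
    (h : IsCcw (p a - p v) (p b - p v) (p c - p v)) :
    IsCcw (q a - q v) (q b - q v) (q c - q v) := by
  obtain ⟨d, u, h1, h2, h3⟩ := D.fan v
  have hu : ∀ w, D.graph.Adj v w → ∃ i ≤ d, u i = w := by
    rintro _ ⟨hne, f, i, j, rfl, rfl⟩
    rcases fin_three_cases i j with rfl | rfl | rfl
    · exact absurd rfl hne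
    · exact (h3 f i rfl).1
    · exact (h3 f i rfl).2
  obtain ⟨i, hi, rfl⟩ := hu a ha
  obtain ⟨j, hj, rfl⟩ := hu b hb
  obtain ⟨k, hk, rfl⟩ := hu c hc
  obtain ⟨hab, hbc, hac⟩ := h.ne
  have hij : i ≠ j := fun e => hab (by rw [e])
  have hjk : j ≠ k := fun e => hbc (by rw [e])
  have hik : i ≠ k := fun e => hac (by rw [e])
  rcases lt_or_gt_of_ne hij with hij | hij <;> rcases lt_or_gt_of_ne hjk with hjk | hjk <;>
  rcases lt_or_gt_of_ne hik with hik | hik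
  · exact hq.isCcw_of_fan h1 h2 hij hjk hk
  · omega
  · exact absurd h (hp.isCcw_of_fan h1 h2 hik hjk hj).not_swap
  · exact (hq.isCcw_of_fan h1 h2 hik hij hj).rotate
  · exact absurd h.rotate (hp.isCcw_of_fan h1 h2 hij hik hk).not_swap
  · exact (hq.isCcw_of_fan h1 h2 hjk hik hi).rotate.rotate
  · omega
  · exact absurd h.rotate.rotate (hp.isCcw_of_fan h1 h2 hjk hij hi).not_swap

theorem sameRotation (hp : D.Oriented p) (hq : D.Oriented q) : SameRotation D.graph p q :=
  fun _ _ _ _ ha hb hc => ⟨hp.isCcw_imp hq ha hb hc, hq.isCcw_imp hp ha hb hc⟩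

theorem equivalent (hp : D.Oriented p) (hq : D.Oriented q) : Equivalent D.graph p q :=
  ⟨hp.sameRotation hq, _, _, _, hp.isOuterTriangle, hq.isOuterTriangle⟩

/-! ### Reduction of area-universality to approximate realization -/

/-- The plane triangulation given by an oriented placement of a triangulated disk. -/
def toPlaneTriangulation (hp : D.Oriented p) : PlaneTriangulation V where
  graph := D.graph
  pos := p
  planar := hp.isPlanar
  triangular C hC := by
    rcases hp.eq_of_isFace hC with ⟨f, rfl⟩ | rfl
    · exact ⟨_, _, _, hp.isTriangularFace_openTriangle f⟩
    · exact ⟨_, _, _, hp.isTriangularFace_compl⟩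

/-- The vertices `a`, `b`, `c` are known only through the frontier. The midpoint of each of their
edges lies in the closed face, which forces the ends to be corners of `f`. -/
theorem triangleArea_eq_of_isTriangularFace (hp : D.Oriented p) {f : F} {a b c : V}
    (h : IsTriangularFace D.graph p (openTriangle (D.face p f)) a b c) (q : V → ℝ × ℝ) :
    triangleArea (q a) (q b) (q c) =
      |turn (D.face q f 0) (D.face q f 1) (D.face q f 2)| / 2 := by
  obtain ⟨-, hab, hbc, hca, hfr⟩ := h
  have key : ∀ u v, D.graph.Adj u v → segment ℝ (p u) (p v) ⊆ triangleBoundary (p a) (p b) (p c) →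
      (∃ i, D.corner f i = u) ∧ ∃ j, D.corner f j = v := by
    intro u v huv hsub
    obtain ⟨hz1, hz2⟩ := lineMap_ne (a := p u) (b := p v) (s := 1 / 2)
      (fun h => huv.1 (hp.position_injective h)) (by norm_num) (by norm_num)
    have hm := lineMap_mem_segment (a := p u) (b := p v) (by norm_num : (0 : ℝ) ≤ 1 / 2)
      (by norm_num)
    have hc := hsub hm
    rw [← hfr, frontier_openTriangle (hp f), ← closedTriangle_diff_openTriangle (hp f)] at hc
    obtain ⟨k, hk, -⟩ := hp.exists_corners_of_inner_point_mem huv hm hz1 hz2 hc.1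
    rcases hk with hk | hk
    exacts [⟨⟨_, hk.1⟩, _, hk.2⟩, ⟨⟨_, hk.2⟩, _, hk.1⟩]
  obtain ⟨⟨i, hi⟩, j, hj⟩ := key a b hab fun x hx => Or.inl (Or.inl hx)
  obtain ⟨-, k, hk⟩ := key b c hbc fun x hx => Or.inl (Or.inr hx)
  have := triangleArea_eq (D.face q f) (i := i) (j := j) (k := k)
    (fun e => hab.1 (by rw [← hi, ← hj, e])) (fun e => hbc.1 (by rw [← hj, ← hk, e]))
    (fun e => hca.1 (by rw [← hi, ← hk, e]))
  simpa only [face, hi, hj, hk] using this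

/-- An equiaffine transformation moves the drawing into a square that depends only on the area. -/
theorem exists_normalized (hp : D.Oriented p) : ∃ q : V → ℝ × ℝ, D.Oriented q ∧
    (∀ f, turn (D.face q f 0) (D.face q f 1) (D.face q f 2) =
      turn (D.face p f 0) (D.face p f 1) (D.face p f 2)) ∧
    ∀ v, q v ∈ Set.Icc (0 : ℝ × ℝ) (√(turn (D.hull p 0) (D.hull p 1) (D.hull p 2)),
      √(turn (D.hull p 0) (D.hull p 1) (D.hull p 2))) := by
  obtain ⟨τ, hτ⟩ : ∃ τ, τ = turn (D.hull p 0) (D.hull p 1) (D.hull p 2) := ⟨_, rfl⟩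
  have hτ0 : 0 < τ := hτ ▸ hp.hull_isPositive
  have hs := Real.sq_sqrt hτ0.le
  rw [← hτ]
  have hs0 : 0 < √τ := Real.sqrt_pos.2 hτ0
  generalize √τ = s at hs hs0
  -- Barycentric coordinates, scaled to determinant 1: the outer triangle becomes a right isosceles
  -- triangle with legs `√τ` on the axes.
  let L : ℝ × ℝ → ℝ × ℝ := fun x =>
    (s / τ * turn (D.hull p 2) (D.hull p 0) x, s / τ * turn (D.hull p 0) (D.hull p 1) x)
  have hL : ∀ a b c, turn (L a) (L b) (L c) = turn a b c := by
    intro a b c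
    have e : turn (L a) (L b) (L c) = (s / τ) ^ 2 *
        (turn (D.hull p 0) (D.hull p 1) (D.hull p 2) * turn a b c) := by
      simp only [L, turn_def]
      ring
    rw [e, ← hτ, div_pow, hs]
    field_simp
  refine ⟨fun v => L (p v), fun f => ?_, fun f => hL _ _ _, fun v => ?_⟩
  · show 0 < turn (L _) (L _) (L _)
    rw [hL]
    exact hp f
  · obtain ⟨f, k, hk⟩ := D.exists_corner v
    have hv := hp.closedTriangle_subset f (corner_mem_closedTriangle (hp f) k)
    rw [show D.face p f k = p v by simp only [face, hk]] at hv
    have h0 : 0 ≤ turn (D.hull p 0) (D.hull p 1) (p v) := hv 0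
    have h1 : 0 ≤ turn (D.hull p 1) (D.hull p 2) (p v) := hv 1
    have h2 : 0 ≤ turn (D.hull p 2) (D.hull p 0) (p v) := hv 2
    have hsum := turn_add_turn_add_turn (D.hull p 0) (D.hull p 1) (D.hull p 2) (p v)
    rw [← hτ] at hsum
    have hb : ∀ y, 0 ≤ y → y ≤ τ → 0 ≤ s / τ * y ∧ s / τ * y ≤ s := by
      intro y hy hy'
      refine ⟨by positivity, ?_⟩
      rw [div_mul_eq_mul_div, div_le_iff₀ hτ0]
      exact mul_le_mul_of_nonneg_left hy' hs0.le
    have b1 := hb _ h2 (by linarith)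
    have b2 := hb _ h0 (by linarith)
    exact ⟨⟨b1.1, b2.1⟩, b1.2, b2.2⟩

/-- A triangulation is area-universal if arbitrarily small perturbations of each area assignment
are realized by oriented placements. -/
theorem areaUniversal [Countable V] (hp : D.Oriented p)
    (H : ∀ A : F → ℝ, (∀ f, 0 ≤ A f) → ∀ δ > 0, ∃ q, D.Oriented q ∧
      ∀ f, |turn (D.face q f 0) (D.face q f 1) (D.face q f 2) - A f| < δ) :
    hp.toPlaneTriangulation.AreaUniversal := by
  intro A
  have hinner : ∀ f, IsFace D.graph p (openTriangle (D.face p f)) ∧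
      Bornology.IsBounded (openTriangle (D.face p f)) := fun f => ⟨hp.isFace_openTriangle f,
    (isBounded_closedTriangle (hp f)).subset (openTriangle_subset_closedTriangle _)⟩
  -- The factor 2 is there because `turn` is twice the area.
  let a : F → ℝ := fun f => 2 * (A ⟨_, hinner f⟩ : ℝ)
  have ha : ∀ f, 0 ≤ a f := fun f => by positivity
  have hk : ∀ k : ℕ, ∃ q, D.Oriented q ∧
      (∀ f, |turn (D.face q f 0) (D.face q f 1) (D.face q f 2) - a f| < 1 / ((k : ℝ) + 1)) ∧
      ∀ v, q v ∈ Set.Icc (0 : ℝ × ℝ) (√(∑ f, (a f + 1)), √(∑ f, (a f + 1))) := by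
    intro k
    obtain ⟨q₀, hq₀, hq₀'⟩ := H a ha (1 / ((k : ℝ) + 1)) (by positivity)
    obtain ⟨q, hq, hqf, hqv⟩ := hq₀.exists_normalized
    refine ⟨q, hq, fun f => by rw [hqf]; exact hq₀' f, fun v => ?_⟩
    -- Every tolerance is at most 1, so the outer area, and with it the square containing the
    -- drawing, is bounded independently of `k`.
    have hle : turn (D.hull q₀ 0) (D.hull q₀ 1) (D.hull q₀ 2) ≤ ∑ f, (a f + 1) := by
      rw [← D.sum_turn_face]
      refine Finset.sum_le_sum fun f _ => ?_
      have h1 := (abs_lt.1 (hq₀' f)).2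
      have h2 : 1 / ((k : ℝ) + 1) ≤ 1 := by
        rw [div_le_one (by positivity)]
        linarith [(Nat.cast_nonneg k : (0 : ℝ) ≤ k)]
      linarith
    exact ⟨(hqv v).1, (hqv v).2.trans ⟨Real.sqrt_le_sqrt hle, Real.sqrt_le_sqrt hle⟩⟩
  choose q hq hqf hqv using hk
  obtain ⟨E, -, φ, hφ, hE⟩ := (isCompact_univ_pi fun _ : V => isCompact_Icc).tendsto_subseq
    (x := q) fun k v _ => hqv k v
  refine ⟨E, ⟨fun k => q (φ k), fun k => ⟨(hq _).isPlanar, hp.equivalent (hq _)⟩, hE⟩, ?_⟩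
  rintro ⟨C, hC, hCb⟩ u v w hface
  rcases hp.eq_of_isFace hC with ⟨f, rfl⟩ | rfl
  · have h1 : Filter.Tendsto (fun k => turn (D.face (q (φ k)) f 0) (D.face (q (φ k)) f 1)
        (D.face (q (φ k)) f 2)) Filter.atTop
        (𝓝 (turn (D.face E f 0) (D.face E f 1) (D.face E f 2))) := by
      have hc : Continuous fun q : V → ℝ × ℝ =>
          turn (D.face q f 0) (D.face q f 1) (D.face q f 2) := by
        unfold face
        fun_prop
      exact (hc.tendsto E).comp hE
    have h2 : Filter.Tendsto (fun k => turn (D.face (q k) f 0) (D.face (q k) f 1)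
        (D.face (q k) f 2)) Filter.atTop (𝓝 (a f)) := by
      rw [tendsto_iff_dist_tendsto_zero]
      exact squeeze_zero (fun _ => dist_nonneg) (fun k => (hqf k f).le)
        tendsto_one_div_add_atTop_nhds_zero_nat
    have h3 := tendsto_nhds_unique h1 (h2.comp hφ.tendsto_atTop)
    rw [hp.triangleArea_eq_of_isTriangularFace hface, h3, abs_of_nonneg (ha f)]
    show 2 * (A _ : ℝ) / 2 = _
    rw [mul_div_cancel_left₀ _ two_ne_zero]
  · exact absurd hCb (not_isBounded_compl_closedTriangle hp.hull_isPositive)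

end Oriented

end DiskTriangulation

/-! ### Real roots of odd polynomials and the insertion of two vertices -/

namespace Polynomial

theorem exists_isRoot_of_odd_of_coeff_pos {f : ℝ[X]} {m : ℕ} (hm : Odd m) (hf : f.natDegree ≤ m)
    (hc : 0 < f.coeff m) : ∃ x, f.IsRoot x := by
  have hdeg : f.natDegree = m := le_antisymm hf (le_natDegree_of_ne_zero hc.ne')
  have hf0 : f ≠ 0 := by rintro rfl; simp at hc
  have hm0 : 0 < m := hm.pos
  have hpos : 0 < f.degree := natDegree_pos_iff_degree_pos.1 (hdeg ▸ hm0)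
  have h1 := f.tendsto_atTop_of_leadingCoeff_nonneg hpos
    (by rw [leadingCoeff, hdeg]; exact hc.le)
  have hcomp : (f.comp (-X)).natDegree = m := by
    rw [natDegree_comp, natDegree_neg, natDegree_X, mul_one, hdeg]
  have h2 := (f.comp (-X)).tendsto_atBot_of_leadingCoeff_nonpos
    (natDegree_pos_iff_degree_pos.1 (hcomp ▸ hm0)) (by
      rw [leadingCoeff_comp (by simp), leadingCoeff_neg, leadingCoeff_X, hdeg, hm.neg_one_pow,
        leadingCoeff, hdeg]
      linarith)
  obtain ⟨x, hx⟩ := (h1.eventually_ge_atTop 0).exists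
  obtain ⟨y, hy⟩ := (h2.eventually_le_atBot 0).exists
  rw [eval_comp] at hy
  obtain ⟨z, hz⟩ := mem_range_of_exists_le_of_exists_ge f.continuous ⟨_, hy⟩ ⟨x, hx⟩
  exact ⟨z, hz⟩

end Polynomial

/-- Two vertices `X` and `W` can be inserted next to an edge from `b` to `a` when the parameters
satisfy an equation that is cubic in the coordinates of `a` and `b`. -/
theorem exists_insertion {a b : ℝ × ℝ} {p q r t B K : ℝ} (hD : 0 < a.2 - b.2)
    (hsum₀ : 0 < p + q + r + t) (hK : K ≠ 0) (hKab : K = -PlaneDrawing.det b a - (p + q))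
    (heq : K ^ 2 * (a.2 + B + p + r) + K * ((p + q) * (a.2 + B + p + r) + (r * q - p * t) -
      (p + q + r + t) * a.2 + (p + r) * (a.2 - b.2)) +
      (r * q - p * t) * (p + q + (a.2 - b.2)) = 0) :
    ∃ W Y : ℝ × ℝ, turn 0 a Y = p ∧ turn 0 Y b = q ∧ turn Y a W = r ∧ turn Y W b = t ∧
      turn (1, 0) W a = B := by
  obtain ⟨xa, H⟩ := a
  obtain ⟨xb, h⟩ := b
  simp only [PlaneDrawing.det] at *
  -- With `X` the inserted vertex next to `0`, the number `e` is the determinant of `X` and `W`, and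
  -- `K` is twice the signed area of `X`, `a`, `b`. The Plücker relation of `a`, `X`, `W`, `b`
  -- becomes `e * K = r * q - p * t`.
  obtain ⟨e, he⟩ : ∃ e, e = (r * q - p * t) / K := ⟨_, rfl⟩
  have heK : e * K = r * q - p * t := by rw [he]; field_simp
  rw [← heK] at heq
  have heq' : K * (H + B + p + r) + (p + q) * (H + B + p + r) + e * K -
      (p + q + r + t) * H + (p + r) * (H - h) + e * (p + q + (H - h)) = 0 := by
    have : K * (K * (H + B + p + r) + (p + q) * (H + B + p + r) + e * K -
      (p + q + r + t) * H + (p + r) * (H - h) + e * (p + q + (H - h))) = 0 := by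
      linear_combination heq
    exact (mul_eq_zero.1 this).resolve_left hK
  obtain ⟨s, hs⟩ : ∃ s, s = p + q + r + t := ⟨_, rfl⟩
  -- The determinants of `a`, `W` and of `W`, `b` must be `y` and `s - y`, and the triangle with the
  -- apex `(1, 0)` then fixes the height `hw` of `W`.
  obtain ⟨y, hy⟩ : ∃ y, y = p + r + e := ⟨_, rfl⟩
  obtain ⟨hw, hhw⟩ : ∃ hw, hw = H + y + B := ⟨_, rfl⟩
  obtain ⟨xw, hxw⟩ : ∃ xw, xw = ((xa - xb) * hw - s) / (H - h) := ⟨_, rfl⟩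
  have hs0 : s ≠ 0 := hs ▸ hsum₀.ne'
  have hxw' : xw * (H - h) = (xa - xb) * hw - s := by rw [hxw]; field_simp
  -- Only the abscissa of `W` is left to satisfy two linear equations; this is their compatibility
  -- condition.
  have root : hw * (xb * H - h * xa) + H * s - y * (H - h) = 0 := by
    rw [hhw, hy, hs, show xb * H - h * xa = -K - (p + q) by linarith]
    linear_combination -heq'
  have haw : xa * hw - H * xw = y := by
    have : (xa * hw - H * xw - y) * (H - h) = 0 := by linear_combination root - H * hxw'
    exact sub_eq_zero.1 ((mul_eq_zero.1 this).resolve_right hD.ne')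
  have hwb : xw * h - hw * xb = s - y := by linear_combination -hxw' - haw
  refine ⟨(xw, hw), (((p + q) * xw + e * (xa - xb)) / s, ((p + q) * hw + e * (H - h)) / s), ?_⟩
  obtain ⟨X, hX⟩ : ∃ X, X = ((p + q) * xw + e * (xa - xb)) / s := ⟨_, rfl⟩
  obtain ⟨Y, hY⟩ : ∃ Y, Y = ((p + q) * hw + e * (H - h)) / s := ⟨_, rfl⟩
  have hX' : X * s = (p + q) * xw + e * (xa - xb) := by rw [hX]; field_simp
  have hY' : Y * s = (p + q) * hw + e * (H - h) := by rw [hY]; field_simp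
  rw [← hX, ← hY]
  have cancel : ∀ {u w : ℝ}, u * s = w * s → u = w := fun h => mul_right_cancel₀ hs0 h
  have haX : xa * Y - H * X = p := by
    refine cancel ?_
    linear_combination xa * hY' - H * hX' + (p + q) * haw + e * hKab - heK + (p + q) * hy - p * hs
  have hXb : X * h - Y * xb = q := by
    refine cancel ?_
    linear_combination h * hX' - xb * hY' + (p + q) * hwb - e * hKab + heK - (p + q) * hy +
      (p + q - q) * hs
  have hXW : X * hw - Y * xw = e := by
    refine cancel ?_
    linear_combination hw * hX' - xw * hY' + e * haw + e * hwb
  simp only [turn_def, Prod.fst_zero, Prod.snd_zero]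
  refine ⟨?_, ?_, ?_, ?_, ?_⟩
  · linear_combination haX
  · linear_combination hXb
  · linear_combination haw - haX - hXW + hy
  · linear_combination hwb - hXb + hXW + hs - hy
  · linear_combination -haw + hhw

/-! ### The strip between the two apices as a function of one height -/

namespace Strip

open Polynomial

/-- The heights of the vertices of the strip above its first vertex. -/
def height (α β : ℕ → ℝ) (i : ℕ) : ℝ := ∑ k ∈ Finset.range i, (α k + β k)

variable (α β : ℕ → ℝ)

/-- The product of the heights of the vertices `1, …, i` as a polynomial in the height of vertex
`0`. -/
noncomputable def heightProd (i : ℕ) : ℝ[X] :=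
  ∏ k ∈ Finset.range i, (X + C (height α β (k + 1)))

/-- The determinant of the vertices `0` and `i + 1`, multiplied by `heightProd α β i`, as a
polynomial in the height of vertex `0`. -/
noncomputable def chord : ℕ → ℝ[X]
  | 0 => C (α 0)
  | i + 1 => chord i * (X + C (height α β (i + 2))) + heightProd α β i * (C (α (i + 1)) * X)

theorem height_succ (i : ℕ) : height α β (i + 1) = height α β i + (α i + β i) :=
  Finset.sum_range_succ _ _

theorem heightProd_succ (i : ℕ) :
    heightProd α β (i + 1) = heightProd α β i * (X + C (height α β (i + 1))) :=
  Finset.prod_range_succ _ _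

theorem heightProd_natDegree_coeff (i : ℕ) :
    (heightProd α β i).natDegree ≤ i ∧ (heightProd α β i).coeff i = 1 := by
  have hm : (heightProd α β i).Monic := monic_prod_of_monic _ _ fun k _ => monic_X_add_C _
  have hd : (heightProd α β i).natDegree = i := by
    rw [heightProd, natDegree_prod_of_monic _ _ fun k _ => monic_X_add_C _]
    simp
  exact ⟨hd.le, by simpa [leadingCoeff, hd] using hm.leadingCoeff⟩

theorem chord_natDegree_coeff (i : ℕ) : (chord α β i).natDegree ≤ i ∧
    (chord α β i).coeff i = ∑ k ∈ Finset.range (i + 1), α k := by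
  induction i with
  | zero => simp [chord]
  | succ i ih =>
    obtain ⟨h1, h2⟩ := heightProd_natDegree_coeff α β i
    have hX : (X + C (height α β (i + 2))).natDegree ≤ 1 := (natDegree_X_add_C _).le
    have hαX : (C (α (i + 1)) * X).natDegree ≤ 1 :=
      (natDegree_C_mul_le _ _).trans natDegree_X_le
    constructor
    · refine natDegree_add_le_of_degree_le (natDegree_mul_le_of_le ih.1 hX) ?_
      exact natDegree_mul_le_of_le h1 hαX
    · rw [chord, coeff_add, coeff_mul_add_eq_of_natDegree_le ih.1 hX,
        coeff_mul_add_eq_of_natDegree_le h1 hαX, ih.2, h2,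
        Finset.sum_range_succ _ (i + 1)]
      simp [coeff_X, coeff_C]

variable {α β}

theorem height_strictMono (hα : ∀ i, 0 < α i) (hβ : ∀ i, 0 < β i) : StrictMono (height α β) :=
  strictMono_nat_of_lt_succ fun i => by
    rw [height_succ]
    linarith [hα i, hβ i]

theorem eval_heightProd (i : ℕ) (z : ℝ) :
    (heightProd α β i).eval z = ∏ k ∈ Finset.range i, (z + height α β (k + 1)) := by
  simp [heightProd, eval_prod]

/-- When vertex `j + 1` has height 0, the second summand in the recursion of `chord` vanishes beyond
index `j + 1`, and each further step multiplies by a positive height. The value at `j + 1` is a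
nonzero multiple of `α j * β (j + 1) - α (j + 1) * β j`. -/
theorem eval_chord_ne_zero (hα : ∀ i, 0 < α i) (hβ : ∀ i, 0 < β i) {l j : ℕ} (hj : j < l)
    (hne : ∀ i < l, α i * β (i + 1) ≠ α (i + 1) * β i) :
    (chord α β l).eval (-height α β (j + 1)) ≠ 0 := by
  have hmono := height_strictMono hα hβ
  have start : (chord α β (j + 1)).eval (-height α β (j + 1)) ≠ 0 := by
    have hj' := hne j hj
    cases j with
    | zero =>
      simp only [chord, heightProd, Finset.range_zero, Finset.prod_empty, eval_add, eval_mul,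
        eval_C, eval_X, eval_one]
      rw [height_succ _ _ 1, height_succ _ _ 0]
      simp only [height, Finset.range_zero, Finset.sum_empty, zero_add] at hj' ⊢
      intro h
      apply hj'
      linear_combination h
    | succ j =>
      have e : (chord α β (j + 1 + 1)).eval (-height α β (j + 1 + 1)) =
          -height α β (j + 1 + 1) * (heightProd α β j).eval (-height α β (j + 1 + 1)) *
            (α (j + 1) * β (j + 1 + 1) - α (j + 1 + 1) * β (j + 1)) := by
        rw [chord, chord, heightProd_succ]
        simp only [eval_add, eval_mul, eval_C, eval_X]
        rw [height_succ _ _ (j + 2), height_succ _ _ (j + 1)]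
        ring
      rw [e]
      refine mul_ne_zero (mul_ne_zero (neg_ne_zero.2 ?_) ?_) (sub_ne_zero.2 hj')
      · have := hmono (Nat.succ_pos (j + 1))
        rw [height, Finset.range_zero, Finset.sum_empty] at this
        exact this.ne'
      · rw [eval_heightProd]
        refine Finset.prod_ne_zero_iff.2 fun k hk => ?_
        have := hmono (show k + 1 < j + 1 + 1 by have := Finset.mem_range.1 hk; omega)
        linarith
  have hj1 : j + 1 ≤ l := hj
  clear hj hne
  induction l, hj1 using Nat.le_induction with
  | base => exact start
  | succ i hi ih =>
    have h0 : (heightProd α β i).eval (-height α β (j + 1)) = 0 := by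
      rw [eval_heightProd]
      exact Finset.prod_eq_zero (Finset.mem_range.2 hi) (neg_add_cancel _)
    rw [chord]
    simp only [eval_add, eval_mul, eval_C, eval_X, h0, zero_mul, add_zero]
    refine mul_ne_zero ih ?_
    have := hmono (show j + 1 < i + 2 by omega)
    linarith

/-- The abscissa of vertex `i + 1` of the strip whose vertex `0` has height `z`. -/
noncomputable def abscissa (α β : ℕ → ℝ) (z : ℝ) : ℕ → ℝ
  | 0 => 0
  | i + 1 => (abscissa α β z i * (z + height α β (i + 2)) - α (i + 1)) / (z + height α β (i + 1))

/-- The vertices of the strip whose vertex `0` has height `z`. -/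
noncomputable def vertex (α β : ℕ → ℝ) (z : ℝ) : ℕ → ℝ × ℝ
  | 0 => (α 0 / (z + height α β 1), z)
  | i + 1 => (abscissa α β z i, z + height α β (i + 1))

theorem vertex_snd (z : ℝ) (i : ℕ) : (vertex α β z i).2 = z + height α β i := by
  cases i <;> simp [vertex, height]

theorem det_vertex {l : ℕ} (hl : 0 < l) {z : ℝ}
    (hz : ∀ j < l, z + height α β (j + 1) ≠ 0) {i : ℕ} (hi : i ≤ l) :
    PlaneDrawing.det (vertex α β z i) (vertex α β z (i + 1)) = α i := by
  cases i with
  | zero =>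
    have := hz 0 hl
    simp only [PlaneDrawing.det, vertex, abscissa]
    field_simp
    ring
  | succ i =>
    have := hz i hi
    simp only [PlaneDrawing.det, vertex, abscissa]
    field_simp
    ring

/-- The recursion of `chord` is the Plücker relation of `(1, 0)` and the vertices `0`, `i + 1`, `i +
2`, in which determinants with `(1, 0)` are heights; `heightProd` clears the denominators. -/
theorem det_vertex_zero {l : ℕ} (hl : 0 < l) {z : ℝ}
    (hz : ∀ j < l, z + height α β (j + 1) ≠ 0) {i : ℕ} (hi : i ≤ l) :
    PlaneDrawing.det (vertex α β z 0) (vertex α β z (i + 1)) * (heightProd α β i).eval z =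
      (chord α β i).eval z := by
  induction i with
  | zero => simp [det_vertex hl hz hi, chord, heightProd]
  | succ i ih =>
    have h1 := det_vertex hl hz hi
    have h2 := ih (by omega)
    have e0 := vertex_snd (α := α) (β := β) z 0
    have e1 := vertex_snd (α := α) (β := β) z (i + 1)
    have e2 := vertex_snd (α := α) (β := β) z (i + 1 + 1)
    rw [chord, heightProd_succ]
    simp only [eval_add, eval_mul, eval_C, eval_X, ← h2]
    simp only [PlaneDrawing.det, height, Finset.range_zero, Finset.sum_empty, add_zero] at *
    rw [← e1, show i + 2 = i + 1 + 1 from rfl, ← e2]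
    linear_combination (heightProd α β i).eval z * (vertex α β z 0).2 * h1 +
      (heightProd α β i).eval z * α (i + 1) * e0

/-- A quadratic form in two polynomials of degree `l`, with coefficients of degrees `1`, `1`, `0`
and a positive coefficient in degree `2 * l + 1`, has a root. -/
theorem exists_root_of_quadratic_form {κ π : ℝ[X]} {l : ℕ} {k u : ℝ} (hκ : κ.natDegree ≤ l)
    (hκl : κ.coeff l = k) (hπ : π.natDegree ≤ l) (hπl : π.coeff l = 1) (hk : 0 < k * k + k * u)
    (c₁ c₂ c₃ : ℝ) :
    ∃ z, κ.eval z * κ.eval z * (z + c₁) + κ.eval z * π.eval z * (u * z + c₂) +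
      c₃ * (π.eval z * π.eval z) = 0 := by
  have d1 : (κ * κ).natDegree ≤ l + l := natDegree_mul_le_of_le hκ hκ
  have d2 : (κ * π).natDegree ≤ l + l := natDegree_mul_le_of_le hκ hπ
  have d3 : (π * π).natDegree ≤ l + l := natDegree_mul_le_of_le hπ hπ
  have e1 : (X + C c₁).natDegree ≤ 1 := (natDegree_X_add_C _).le
  have e2 : (C u * X + C c₂).natDegree ≤ 1 := natDegree_linear_le
  have b1 := natDegree_mul_le_of_le d1 e1
  have b2 := natDegree_mul_le_of_le d2 e2
  have b3 : (C c₃ * (π * π)).natDegree ≤ l + l := (natDegree_C_mul_le _ _).trans d3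
  obtain ⟨z, hz⟩ := exists_isRoot_of_odd_of_coeff_pos (m := l + l + 1)
    (f := κ * κ * (X + C c₁) + κ * π * (C u * X + C c₂) + C c₃ * (π * π)) ⟨l, by ring⟩
    (natDegree_add_le_of_degree_le (natDegree_add_le_of_degree_le b1 b2)
      (b3.trans (Nat.le_succ _))) (by
    rw [coeff_add, coeff_add, coeff_mul_add_eq_of_natDegree_le d1 e1,
      coeff_mul_add_eq_of_natDegree_le d2 e2, coeff_eq_zero_of_natDegree_lt (Nat.lt_succ_of_le b3),
      coeff_mul_add_eq_of_natDegree_le hκ hκ, coeff_mul_add_eq_of_natDegree_le hκ hπ, hκl, hπl]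
    simp only [coeff_add, coeff_X_one, coeff_C_mul, coeff_C_succ, add_zero, mul_one]
    exact hk)
  refine ⟨z, ?_⟩
  simpa only [IsRoot.def, eval_add, eval_mul, eval_C, eval_X] using hz

/-- Every generic assignment of areas to the inner faces is realized. -/
theorem exists_realization {l : ℕ} (hl : 0 < l) (hα : ∀ i, 0 < α i) (hβ : ∀ i, 0 < β i)
    {p q r t B : ℝ} (hp : 0 < p) (hq : 0 < q) (hr : 0 < r) (ht : 0 < t) (hB : 0 < B)
    (hE : r * q - p * t ≠ 0) (hne : ∀ i < l, α i * β (i + 1) ≠ α (i + 1) * β i) :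
    ∃ (v : ℕ → ℝ × ℝ) (W Y : ℝ × ℝ),
      (∀ i ≤ l, turn 0 (v i) (v (i + 1)) = α i ∧ turn (1, 0) (v (i + 1)) (v i) = β i) ∧
      turn 0 (v (l + 1)) Y = p ∧ turn 0 Y (v 0) = q ∧ turn Y (v (l + 1)) W = r ∧
      turn Y W (v 0) = t ∧ turn (1, 0) W (v (l + 1)) = B := by
  have hmono := height_strictMono hα hβ
  have hD : 0 < height α β (l + 1) := by
    have := hmono (Nat.succ_pos l)
    rwa [height, Finset.range_zero, Finset.sum_empty] at this
  obtain ⟨D, hDdef⟩ : ∃ D, D = height α β (l + 1) := ⟨_, rfl⟩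
  rw [← hDdef] at hD
  -- The number `K` of `exists_insertion` is `κ / heightProd`; its quadratic equation, multiplied by
  -- `heightProd ^ 2`, is solved next.
  obtain ⟨κ, hκ⟩ : ∃ κ, κ = -chord α β l - C (p + q) * heightProd α β l := ⟨_, rfl⟩
  obtain ⟨z, hQz⟩ : ∃ z, κ.eval z * κ.eval z * (z + (D + B + p + r)) +
      κ.eval z * (heightProd α β l).eval z * (-(r + t) * z + ((p + q) * (D + B + p + r) +
        (r * q - p * t) - (p + q + r + t) * D + (p + r) * D)) +
      (r * q - p * t) * (p + q + D) * ((heightProd α β l).eval z * (heightProd α β l).eval z) =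
        0 := by
    obtain ⟨c1, c2⟩ := chord_natDegree_coeff α β l
    obtain ⟨d1, d2⟩ := heightProd_natDegree_coeff α β l
    have k1 : κ.natDegree ≤ l := by
      rw [hκ]
      exact (natDegree_sub_le_of_le ((natDegree_neg _).trans_le c1)
        ((natDegree_C_mul_le _ _).trans d1)).trans_eq (max_self l)
    have k2 : κ.coeff l = -∑ k ∈ Finset.range (l + 1), α k - (p + q) := by
      rw [hκ, coeff_sub, coeff_neg, coeff_C_mul, c2, d2, mul_one]
    have hsum : 0 < ∑ k ∈ Finset.range (l + 1), α k :=
      Finset.sum_pos (fun k _ => hα k) ⟨0, by simp⟩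
    refine exists_root_of_quadratic_form k1 k2 d1 d2 ?_ _ _ _
    generalize ∑ k ∈ Finset.range (l + 1), α k = L at hsum
    -- The leading coefficient, from the leading coefficient `-(L + p + q)` of `κ` and the linear
    -- coefficient `-(r + t)` of its cofactor in the mixed term.
    have : 0 < (L + p + q) * (L + p + q + r + t) := by positivity
    linarith
  have hκz : κ.eval z = -(chord α β l).eval z - (p + q) * (heightProd α β l).eval z := by
    simp [hκ]
  -- If an inner path vertex had height 0, only the term with `κ ^ 2` would survive, and genericity
  -- makes it nonzero.
  have hz0 : ∀ j < l, z + height α β (j + 1) ≠ 0 := by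
    intro j hj h0
    have hprod : (heightProd α β l).eval z = 0 := by
      rw [eval_heightProd]
      exact Finset.prod_eq_zero (Finset.mem_range.2 hj) h0
    obtain rfl : z = -height α β (j + 1) := by linarith
    have hc := eval_chord_ne_zero hα hβ hj hne
    rw [hprod, mul_zero, sub_zero] at hκz
    rw [hprod, hκz] at hQz
    have hlt := hmono (show j + 1 < l + 1 by omega)
    rw [← hDdef] at hlt
    have : -height α β (j + 1) + (D + B + p + r) ≠ 0 := by linarith
    simp only [mul_zero, zero_mul, add_zero, mul_eq_zero, neg_eq_zero, or_self, hc, this] at hQz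
  have hprod : (heightProd α β l).eval z ≠ 0 := by
    rw [eval_heightProd]
    exact Finset.prod_ne_zero_iff.2 fun k hk => hz0 k (Finset.mem_range.1 hk)
  -- If `κ` vanished, only the last term would survive, and `r * q ≠ p * t` makes it nonzero.
  have hκ0 : κ.eval z ≠ 0 := by
    intro h0
    rw [h0] at hQz
    simp only [zero_mul, zero_add, mul_eq_zero, hE, hprod, or_false, false_or] at hQz
    linarith
  have hchord := det_vertex_zero hl hz0 le_rfl
  have hsnd := vertex_snd (α := α) (β := β) z
  have hsnd0 : (vertex α β z 0).2 = z := rfl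
  obtain ⟨W, Y, hWY⟩ := exists_insertion (a := vertex α β z (l + 1)) (b := vertex α β z 0)
    (p := p) (q := q) (r := r) (t := t) (B := B) (K := κ.eval z / (heightProd α β l).eval z)
    (by rw [hsnd, hsnd0, ← hDdef]; linarith) (by positivity) (div_ne_zero hκ0 hprod)
    (by rw [hκz, ← hchord]; field_simp)
    (by
      rw [hsnd, hsnd0, ← hDdef]
      field_simp
      linear_combination hQz)
  refine ⟨vertex α β z, W, Y, fun i hi => ?_, hWY⟩
  have h1 := det_vertex hl hz0 hi
  have h2 := hsnd i
  have h3 := hsnd (i + 1)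
  rw [height_succ] at h3
  simp only [PlaneDrawing.det, turn_def, Prod.fst_zero, Prod.snd_zero] at *
  exact ⟨by linarith, by linarith⟩

end Strip

/-! ### The accordion triangulation as a triangulated disk -/

namespace Accordion

/-- The faces of the triangulation: the triangles of a strip with two apices, and five more. -/
abbrev Face (l : ℕ) : Type := Fin (l + 1) ⊕ Fin (l + 1) ⊕ Fin 5

/-- The corners of the faces. The apices of the strip are `0` and `1`, the vertices of the strip
are `4, …, l + 5`, and `2` and `3` are two more vertices. -/
def tri (l : ℕ) : Face l → Fin 3 → ℕ
  | .inl i => ![0, 4 + i, 5 + i]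
  | .inr (.inl i) => ![1, 5 + i, 4 + i]
  | .inr (.inr 0) => ![0, l + 5, 2]
  | .inr (.inr 1) => ![0, 2, 4]
  | .inr (.inr 2) => ![2, l + 5, 3]
  | .inr (.inr 3) => ![2, 3, 4]
  | .inr (.inr 4) => ![1, 3, l + 5]

/-- The corners of the outer face. -/
def hullTri : Fin 3 → ℕ := ![1, 3, 4]

variable {l : ℕ}

/-- Turns a statement about all corners of all faces into an explicit list of triples of numbers, on
which `omega` can work. -/
theorem forall_tri {P : ℕ → ℕ → ℕ → Prop} :
    (∀ f k, P (tri l f k) (tri l f (k + 1)) (tri l f (k + 1 + 1))) ↔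
      (∀ j ≤ l, P 0 (4 + j) (5 + j) ∧ P (4 + j) (5 + j) 0 ∧ P (5 + j) 0 (4 + j)) ∧
      (∀ j ≤ l, P 1 (5 + j) (4 + j) ∧ P (5 + j) (4 + j) 1 ∧ P (4 + j) 1 (5 + j)) ∧
      (P 0 (l + 5) 2 ∧ P (l + 5) 2 0 ∧ P 2 0 (l + 5)) ∧ (P 0 2 4 ∧ P 2 4 0 ∧ P 4 0 2) ∧
      (P 2 (l + 5) 3 ∧ P (l + 5) 3 2 ∧ P 3 2 (l + 5)) ∧ (P 2 3 4 ∧ P 3 4 2 ∧ P 4 2 3) ∧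
      (P 1 3 (l + 5) ∧ P 3 (l + 5) 1 ∧ P (l + 5) 1 3) := by
  have key : ∀ f, (∀ k, P (tri l f k) (tri l f (k + 1)) (tri l f (k + 1 + 1))) ↔
      P (tri l f 0) (tri l f 1) (tri l f 2) ∧ P (tri l f 1) (tri l f 2) (tri l f 0) ∧
        P (tri l f 2) (tri l f 0) (tri l f 1) := fun f => by
    simp only [Fin.forall_fin_succ]
    simp
  simp only [key, Sum.forall]
  refine and_congr ?_ (and_congr ?_ ?_)
  · exact ⟨fun h j hj => h ⟨j, Nat.lt_succ_of_le hj⟩, fun h j => h j (Nat.le_of_lt_succ j.2)⟩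
  · exact ⟨fun h j hj => h ⟨j, Nat.lt_succ_of_le hj⟩, fun h j => h j (Nat.le_of_lt_succ j.2)⟩
  · exact ⟨fun h => ⟨h 0, h 1, h 2, h 3, h 4⟩, fun h j => by
      obtain ⟨h0, h1, h2, h3, h4⟩ := h
      fin_cases j
      exacts [h0, h1, h2, h3, h4]⟩

/-- `(a, b, c)` are the corners of a face in counterclockwise order. -/
def IsTri (l a b c : ℕ) : Prop :=
  ∃ f k, tri l f k = a ∧ tri l f (k + 1) = b ∧ tri l f (k + 1 + 1) = c

theorem isTri_all :
    (∀ j ≤ l, IsTri l 0 (4 + j) (5 + j) ∧ IsTri l (4 + j) (5 + j) 0 ∧ IsTri l (5 + j) 0 (4 + j)) ∧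
      (∀ j ≤ l, IsTri l 1 (5 + j) (4 + j) ∧ IsTri l (5 + j) (4 + j) 1 ∧
        IsTri l (4 + j) 1 (5 + j)) ∧
      (IsTri l 0 (l + 5) 2 ∧ IsTri l (l + 5) 2 0 ∧ IsTri l 2 0 (l + 5)) ∧
      (IsTri l 0 2 4 ∧ IsTri l 2 4 0 ∧ IsTri l 4 0 2) ∧
      (IsTri l 2 (l + 5) 3 ∧ IsTri l (l + 5) 3 2 ∧ IsTri l 3 2 (l + 5)) ∧
      (IsTri l 2 3 4 ∧ IsTri l 3 4 2 ∧ IsTri l 4 2 3) ∧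
      (IsTri l 1 3 (l + 5) ∧ IsTri l 3 (l + 5) 1 ∧ IsTri l (l + 5) 1 3) :=
  forall_tri.1 fun f k => ⟨f, k, rfl, rfl, rfl⟩

theorem tri_lt (f : Face l) (k : Fin 3) : tri l f k < l + 6 := by
  revert f k
  refine forall_tri (P := fun a _ _ => a < l + 6) |>.2 ?_
  refine ⟨fun j hj => ?_, fun j hj => ?_, ?_⟩ <;> omega

/-- The path edges cancel between the two triangles on them, and the spokes at each apex telescope
to the two end spokes. -/
theorem sum_tri (w : ℕ → ℕ → ℝ) (hw : ∀ a b, w a b = -w b a) :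
    ∑ f, ∑ k, w (tri l f k) (tri l f (k + 1)) = ∑ k, w (hullTri k) (hullTri (k + 1)) := by
  have e : ∀ t : Fin 3 → ℕ, ∑ k, w (t k) (t (k + 1)) = w (t 0) (t 1) + w (t 1) (t 2) + w (t 2) (t 0)
      := fun t => Fin.sum_univ_three _
  simp only [e, Fintype.sum_sum_type, Fin.sum_univ_five]
  simp only [tri, hullTri, Matrix.cons_val_zero, Matrix.cons_val_one, Matrix.cons_val]
  have h1 := Finset.sum_range_sub (fun i => w 0 (4 + i)) (l + 1)
  have h2 := Finset.sum_range_sub (fun i => w 1 (4 + i)) (l + 1)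
  have h3 : (∑ x : Fin (l + 1), (w 0 (4 + x) + w (4 + x) (5 + x) + w (5 + x) 0)) +
      ∑ x : Fin (l + 1), (w 1 (5 + x) + w (5 + x) (4 + x) + w (4 + x) 1) =
      -(∑ i ∈ Finset.range (l + 1), (w 0 (4 + (i + 1)) - w 0 (4 + i))) +
        ∑ i ∈ Finset.range (l + 1), (w 1 (4 + (i + 1)) - w 1 (4 + i)) := by
    rw [← Finset.sum_neg_distrib, ← Finset.sum_add_distrib, ← Finset.sum_add_distrib,
      Finset.sum_range]
    refine Finset.sum_congr rfl fun x _ => ?_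
    rw [hw (5 + x) 0, hw (5 + x) (4 + x), hw (4 + x) 1, show 4 + ((x : ℕ) + 1) = 5 + x by omega]
    ring
  rw [← add_assoc, h3, h1, h2, show 4 + (l + 1) = l + 5 by omega, hw (l + 5) 2, hw 2 0, hw 4 0,
    hw (l + 5) 3, hw 3 2, hw 4 2, hw (l + 5) 1, hw 4 1]
  ring

theorem opposite_tri (f : Face l) (k : Fin 3) :
    (∃ c, IsTri l (tri l f (k + 1)) (tri l f k) c) ∨
      ∃ j, hullTri j = tri l f k ∧ hullTri (j + 1) = tri l f (k + 1) := by
  revert f k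
  refine forall_tri (P := fun a b _ => (∃ c, IsTri l b a c) ∨
    ∃ j, hullTri j = a ∧ hullTri (j + 1) = b) |>.2 ?_
  obtain ⟨hn, hs, hp, hq, hr, ht, hb⟩ := isTri_all (l := l)
  have hnl := (hn l le_rfl).2.2
  have hsl := (hs l le_rfl).1
  rw [add_comm 5 l] at hnl hsl
  refine ⟨fun j hj => ⟨?_, Or.inl ⟨_, (hs j hj).2.1⟩, ?_⟩,
    fun j hj => ⟨?_, Or.inl ⟨_, (hn j hj).2.1⟩, ?_⟩,
    ⟨Or.inl ⟨_, hnl⟩, Or.inl ⟨_, hr.1⟩, Or.inl ⟨_, hq.1⟩⟩,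
    ⟨Or.inl ⟨_, hp.2.2⟩, Or.inl ⟨_, ht.2.2⟩, Or.inl ⟨_, (hn 0 (Nat.zero_le l)).1⟩⟩,
    ⟨Or.inl ⟨_, hp.2.1⟩, Or.inl ⟨_, hb.2.1⟩, Or.inl ⟨_, ht.1⟩⟩,
    ⟨Or.inl ⟨_, hr.2.2⟩, Or.inr ⟨1, rfl, rfl⟩, Or.inl ⟨_, hq.2.1⟩⟩,
    ⟨Or.inr ⟨0, rfl, rfl⟩, Or.inl ⟨_, hr.2.1⟩, Or.inl ⟨_, hsl⟩⟩⟩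
  · rcases j with _ | j
    · exact Or.inl ⟨_, hq.2.2⟩
    · have := (hn j (by omega)).2.2
      rw [show 5 + j = 4 + (j + 1) by omega] at this
      exact Or.inl ⟨_, this⟩
  · rcases hj.eq_or_lt with rfl | hj
    · rw [add_comm 5 j]
      exact Or.inl ⟨_, hp.1⟩
    · have := (hn (j + 1) hj).1
      rw [show 4 + (j + 1) = 5 + j by omega] at this
      exact Or.inl ⟨_, this⟩
  · rcases hj.eq_or_lt with rfl | hj
    · rw [add_comm 5 j]
      exact Or.inl ⟨_, hb.2.2⟩
    · have := (hs (j + 1) hj).2.2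
      rw [show 4 + (j + 1) = 5 + j by omega] at this
      exact Or.inl ⟨_, this⟩
  · rcases j with _ | j
    · exact Or.inr ⟨2, rfl, rfl⟩
    · have := (hs j (by omega)).1
      rw [show 5 + j = 4 + (j + 1) by omega] at this
      exact Or.inl ⟨_, this⟩

theorem hull_tri (k : Fin 3) : ∃ c, IsTri l (hullTri k) (hullTri (k + 1)) c := by
  obtain ⟨hn, hs, hp, hq, hr, ht, hb⟩ := isTri_all (l := l)
  fin_cases k
  exacts [⟨_, hb.1⟩, ⟨_, ht.2.1⟩, ⟨_, (hs 0 (Nat.zero_le l)).2.2⟩]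

theorem exists_tri {a : ℕ} (ha : a < l + 6) : ∃ b c, IsTri l a b c := by
  obtain ⟨hn, hs, hp, hq, hr, ht, hb⟩ := isTri_all (l := l)
  rcases lt_or_ge a 4 with h | h
  · interval_cases a
    exacts [⟨_, _, hp.1⟩, ⟨_, _, hb.1⟩, ⟨_, _, ht.1⟩, ⟨_, _, ht.2.1⟩]
  · obtain ⟨j, rfl⟩ := Nat.exists_eq_add_of_le h
    rcases (show j ≤ l + 1 by omega).eq_or_lt with rfl | hj
    · have := hp.2.1
      rw [show l + 5 = 4 + (l + 1) by omega] at this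
      exact ⟨_, _, this⟩
    · exact ⟨_, _, (hn j (by omega)).2.1⟩

/-- The neighbors of a vertex in counterclockwise order. -/
def IsFan (l a d : ℕ) (u : ℕ → ℕ) : Prop :=
  (∀ i ≤ d, u i < l + 6) ∧ (∀ i < d, IsTri l a (u i) (u (i + 1))) ∧
    (∀ i ≤ d, 0 < i → u i ≠ u 0) ∧
    ∀ f k, tri l f k = a →
      (∃ i ≤ d, u i = tri l f (k + 1)) ∧ ∃ i ≤ d, u i = tri l f (k + 1 + 1)

theorem exists_isFan_of_four {x a b c e : ℕ} (hb : IsTri l x a b) (hc : IsTri l x b c)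
    (he : IsTri l x c e) (hlt : (a < l + 6 ∧ b < l + 6) ∧ c < l + 6 ∧ e < l + 6)
    (hba : b ≠ a) (hca : c ≠ a) (hea : e ≠ a)
    (hall : ∀ f k, tri l f k = x →
      (a = tri l f (k + 1) ∨ b = tri l f (k + 1) ∨ c = tri l f (k + 1) ∨ e = tri l f (k + 1)) ∧
      (a = tri l f (k + 1 + 1) ∨ b = tri l f (k + 1 + 1) ∨ c = tri l f (k + 1 + 1) ∨
        e = tri l f (k + 1 + 1))) : ∃ d u, IsFan l x d u := by
  have hmem : ∀ y, a = y ∨ b = y ∨ c = y ∨ e = y →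
      ∃ i ≤ 3, (if i = 0 then a else if i = 1 then b else if i = 2 then c else e) = y := by
    rintro y (rfl | rfl | rfl | rfl)
    exacts [⟨0, by omega, rfl⟩, ⟨1, by omega, rfl⟩, ⟨2, by omega, rfl⟩, ⟨3, by omega, rfl⟩]
  refine ⟨3, fun i => if i = 0 then a else if i = 1 then b else if i = 2 then c else e,
    fun i _ => ?_, fun i hi => ?_, fun i hi h0 => ?_,
    fun f k h => ⟨hmem _ (hall f k h).1, hmem _ (hall f k h).2⟩⟩
  · dsimp only
    split_ifs <;> omega
  · interval_cases i
    exacts [hb, hc, he]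
  · interval_cases i
    exacts [hba, hca, hea]

theorem exists_isFan_of_five {x a b c e g : ℕ} (hb : IsTri l x a b) (hc : IsTri l x b c)
    (he : IsTri l x c e) (hg : IsTri l x e g)
    (hlt : (a < l + 6 ∧ b < l + 6) ∧ c < l + 6 ∧ e < l + 6 ∧ g < l + 6)
    (hba : b ≠ a) (hca : c ≠ a) (hea : e ≠ a) (hga : g ≠ a)
    (hall : ∀ f k, tri l f k = x →
      (a = tri l f (k + 1) ∨ b = tri l f (k + 1) ∨ c = tri l f (k + 1) ∨ e = tri l f (k + 1) ∨
        g = tri l f (k + 1)) ∧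
      (a = tri l f (k + 1 + 1) ∨ b = tri l f (k + 1 + 1) ∨ c = tri l f (k + 1 + 1) ∨
        e = tri l f (k + 1 + 1) ∨ g = tri l f (k + 1 + 1))) : ∃ d u, IsFan l x d u := by
  have hmem : ∀ y, a = y ∨ b = y ∨ c = y ∨ e = y ∨ g = y → ∃ i ≤ 4, (if i = 0 then a else
      if i = 1 then b else if i = 2 then c else if i = 3 then e else g) = y := by
    rintro y (rfl | rfl | rfl | rfl | rfl)
    exacts [⟨0, by omega, rfl⟩, ⟨1, by omega, rfl⟩, ⟨2, by omega, rfl⟩, ⟨3, by omega, rfl⟩,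
      ⟨4, by omega, rfl⟩]
  refine ⟨4, fun i => if i = 0 then a else if i = 1 then b else if i = 2 then c else
    if i = 3 then e else g, fun i _ => ?_, fun i hi => ?_, fun i hi h0 => ?_,
    fun f k h => ⟨hmem _ (hall f k h).1, hmem _ (hall f k h).2⟩⟩
  · dsimp only
    split_ifs <;> omega
  · interval_cases i
    exacts [hb, hc, he, hg]
  · interval_cases i
    exacts [hba, hca, hea, hga]

theorem exists_fan {a : ℕ} (ha : a < l + 6) : ∃ d u, IsFan l a d u := by
  obtain ⟨hn, hs, hp, hq, hr, ht, hb⟩ := isTri_all (l := l)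
  rcases lt_or_ge a 4 with h | h
  · interval_cases a
    -- At an inner vertex such as `0` one face is left out of the fan, here `0, 2, 4`, so that the
    -- neighbors do not return to the first one.
    · refine ⟨l + 2, fun i => if i ≤ l + 1 then 4 + i else 2, fun i hi => ?_, fun i hi => ?_,
        fun i hi h0 => ?_, ?_⟩
      · dsimp only
        split_ifs <;> omega
      · rcases (show i ≤ l + 1 by omega).eq_or_lt with rfl | hi'
        · have := hp.1
          simpa [show 4 + (l + 1) = l + 5 by omega]
        · simpa [hi'.le, show i ≤ l by omega, show 4 + (i + 1) = 5 + i by omega]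
            using (hn i (by omega)).1
      · dsimp only
        split_ifs <;> omega
      · have hmem : ∀ y, y = 2 ∨ (4 ≤ y ∧ y ≤ l + 5) →
            ∃ i ≤ l + 2, (if i ≤ l + 1 then 4 + i else 2) = y := by
          rintro y (rfl | ⟨h1, h2⟩)
          · exact ⟨l + 2, le_rfl, if_neg (by omega)⟩
          · exact ⟨y - 4, by omega, by rw [if_pos (by omega)]; omega⟩
        have hall := forall_tri (l := l) (P := fun x y z => x = 0 →
          (y = 2 ∨ (4 ≤ y ∧ y ≤ l + 5)) ∧ (z = 2 ∨ (4 ≤ z ∧ z ≤ l + 5))) |>.2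
          (by refine ⟨fun j hj => ?_, fun j hj => ?_, ?_⟩ <;> omega)
        exact fun f k h => ⟨hmem _ (hall f k h).1, hmem _ (hall f k h).2⟩
    · refine ⟨l + 2, fun i => if i = 0 then 3 else l + 6 - i, fun i hi => ?_, fun i hi => ?_,
        fun i hi h0 => ?_, ?_⟩
      · dsimp only
        split_ifs <;> omega
      · rcases i with _ | i
        · exact hb.1
        · have := (hs (l - i) (by omega)).1
          simpa [show l + 6 - (i + 1) = 5 + (l - i) by omega,
            show l + 6 - (i + 1 + 1) = 4 + (l - i) by omega]
      · dsimp only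
        split_ifs <;> omega
      · have hmem : ∀ y, y = 3 ∨ (4 ≤ y ∧ y ≤ l + 5) →
            ∃ i ≤ l + 2, (if i = 0 then 3 else l + 6 - i) = y := by
          rintro y (rfl | ⟨h1, h2⟩)
          · exact ⟨0, by omega, rfl⟩
          · exact ⟨l + 6 - y, by omega, by rw [if_neg (by omega)]; omega⟩
        have hall := forall_tri (l := l) (P := fun x y z => x = 1 →
          (y = 3 ∨ (4 ≤ y ∧ y ≤ l + 5)) ∧ (z = 3 ∨ (4 ≤ z ∧ z ≤ l + 5))) |>.2
          (by refine ⟨fun j hj => ?_, fun j hj => ?_, ?_⟩ <;> omega)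
        exact fun f k h => ⟨hmem _ (hall f k h).1, hmem _ (hall f k h).2⟩
    · refine exists_isFan_of_four hr.1 ht.1 hq.2.1 (by omega) (by omega) (by omega) (by omega) ?_
      refine forall_tri (P := fun x y z => x = 2 → (l + 5 = y ∨ 3 = y ∨ 4 = y ∨ 0 = y) ∧
        (l + 5 = z ∨ 3 = z ∨ 4 = z ∨ 0 = z)) |>.2 ?_
      refine ⟨fun j hj => ?_, fun j hj => ?_, ?_⟩ <;> omega
    · refine exists_isFan_of_four ht.2.1 hr.2.2 hb.2.1 (by omega) (by omega) (by omega)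
        (by omega) ?_
      refine forall_tri (P := fun x y z => x = 3 → (4 = y ∨ 2 = y ∨ l + 5 = y ∨ 1 = y) ∧
        (4 = z ∨ 2 = z ∨ l + 5 = z ∨ 1 = z)) |>.2 ?_
      refine ⟨fun j hj => ?_, fun j hj => ?_, ?_⟩ <;> omega
  · obtain ⟨i, rfl⟩ := Nat.exists_eq_add_of_le h
    rcases i with _ | i
    · refine exists_isFan_of_five (hs 0 (Nat.zero_le l)).2.2 (hn 0 (Nat.zero_le l)).2.1 hq.2.2
        ht.2.2 (by omega) (by omega) (by omega) (by omega) (by omega) ?_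
      refine forall_tri (P := fun x y z => x = 4 →
        (1 = y ∨ 5 + 0 = y ∨ 0 = y ∨ 2 = y ∨ 3 = y) ∧
        (1 = z ∨ 5 + 0 = z ∨ 0 = z ∨ 2 = z ∨ 3 = z)) |>.2 ?_
      refine ⟨fun j hj => ?_, fun j hj => ?_, ?_⟩ <;> omega
    · have e : 5 + i = 4 + (i + 1) := by omega
      have h1 := (hn i (by omega)).2.2
      have h2 := (hs i (by omega)).2.1
      rw [e] at h1 h2
      rcases (show i ≤ l by omega).eq_or_lt with rfl | hi
      · have e' : i + 5 = 4 + (i + 1) := by omega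
        have h3 := hb.2.2
        have h4 := hr.2.1
        rw [e'] at h3 h4
        refine exists_isFan_of_five h1 h2 h3 h4 (by omega) (by omega) (by omega) (by omega)
          (by omega) ?_
        refine forall_tri (P := fun x y z => x = 4 + (i + 1) →
          (0 = y ∨ 4 + i = y ∨ 1 = y ∨ 3 = y ∨ 2 = y) ∧
          (0 = z ∨ 4 + i = z ∨ 1 = z ∨ 3 = z ∨ 2 = z)) |>.2 ?_
        refine ⟨fun j hj => ?_, fun j hj => ?_, ?_⟩ <;> omega
      · refine exists_isFan_of_four (hn (i + 1) hi).2.1 h1 h2 (by omega) (by omega) (by omega)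
          (by omega) ?_
        refine forall_tri (P := fun x y z => x = 4 + (i + 1) →
          (5 + (i + 1) = y ∨ 0 = y ∨ 4 + i = y ∨ 1 = y) ∧
          (5 + (i + 1) = z ∨ 0 = z ∨ 4 + i = z ∨ 1 = z)) |>.2 ?_
        refine ⟨fun j hj => ?_, fun j hj => ?_, ?_⟩ <;> omega

variable (l) in
/-- The vertex with number `a`. -/
def vert (a : ℕ) : Fin (l + 6) := Fin.ofNat (l + 6) a

theorem val_vert {a : ℕ} (h : a < l + 6) : (vert l a : ℕ) = a := Nat.mod_eq_of_lt h

theorem vert_val (v : Fin (l + 6)) : vert l v = v := Fin.ext (val_vert v.2)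

theorem vert_inj {a b : ℕ} (ha : a < l + 6) (hb : b < l + 6) : vert l a = vert l b ↔ a = b :=
  ⟨fun h => by rw [← val_vert ha, h, val_vert hb], fun h => h ▸ rfl⟩

variable (l) in
/-- The triangulated disk. -/
def disk : DiskTriangulation (Fin (l + 6)) (Face l) where
  corner f k := vert l (tri l f k)
  outer k := vert l (hullTri k)
  sum_corner w hw := sum_tri (fun a b => w (vert l a) (vert l b)) fun _ _ => hw _ _
  opposite f k := by
    rcases opposite_tri f k with ⟨c, g, j, h1, h2, -⟩ | ⟨j, h1, h2⟩
    · exact Or.inl ⟨g, j, congrArg _ h1, congrArg _ h2⟩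
    · exact Or.inr ⟨j, congrArg _ h1, congrArg _ h2⟩
  outer_edge k := by
    obtain ⟨c, g, j, h1, h2, -⟩ := hull_tri (l := l) k
    exact ⟨g, j, congrArg _ h1, congrArg _ h2⟩
  exists_corner v := by
    obtain ⟨b, c, f, k, h, -⟩ := exists_tri v.2
    exact ⟨f, k, by rw [h, vert_val]⟩
  fan v := by
    obtain ⟨d, u, h1, h2, h3, h4⟩ := exists_fan v.2
    refine ⟨d, fun i => vert l (u i), fun i hi => ?_, fun i hi h0 h => ?_, fun f k hk => ?_⟩
    · obtain ⟨f, k, e1, e2, e3⟩ := h2 i hi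
      exact ⟨f, k, by rw [e1, vert_val], by rw [e2], by rw [e3]⟩
    · exact h3 i hi h0 ((vert_inj (h1 i hi) (h1 0 (Nat.zero_le d))).1 h)
    · have hk' : tri l f k = v := by rw [← hk, val_vert (tri_lt f k)]
      obtain ⟨⟨i, hi, e⟩, j, hj, e'⟩ := h4 f k hk'
      exact ⟨⟨i, hi, congrArg _ e⟩, j, hj, congrArg _ e'⟩

theorem adj_of_isTri {a b c : ℕ} (h : IsTri l a b c) (hab : a ≠ b) :
    (disk l).graph.Adj (vert l a) (vert l b) := by
  obtain ⟨f, k, rfl, rfl, -⟩ := h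
  exact ⟨fun e => hab ((vert_inj (tri_lt f k) (tri_lt f (k + 1))).1 e), f, k, k + 1, rfl, rfl⟩

/-! ### 4-connectivity of the accordion -/

/-- Adjacency of the vertices with numbers `a` and `b`. -/
def NAdj (l a b : ℕ) : Prop := (disk l).graph.Adj (vert l a) (vert l b)

theorem nAdj_all : (∀ j ≤ l + 1, NAdj l 0 (4 + j) ∧ NAdj l 1 (4 + j)) ∧
    (∀ j ≤ l, NAdj l (4 + j) (4 + (j + 1))) ∧ NAdj l 0 2 ∧ NAdj l 1 3 ∧ NAdj l 2 3 ∧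
    NAdj l 2 4 ∧ NAdj l 2 (4 + (l + 1)) ∧ NAdj l 3 4 ∧ NAdj l 3 (4 + (l + 1)) := by
  obtain ⟨hn, hs, hp, hq, hr, ht, hb⟩ := isTri_all (l := l)
  have e : l + 5 = 4 + (l + 1) := by omega
  refine ⟨fun j hj => ?_, fun j hj => ?_, adj_of_isTri hq.1 (by omega),
    adj_of_isTri hb.1 (by omega), adj_of_isTri ht.1 (by omega),
    adj_of_isTri hq.2.1 (by omega), e ▸ adj_of_isTri hr.1 (by omega),
    adj_of_isTri ht.2.1 (by omega), e ▸ adj_of_isTri hb.2.1 (by omega)⟩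
  · rcases hj.eq_or_lt with rfl | hj
    · rw [← e]
      exact ⟨adj_of_isTri hp.1 (by omega), (adj_of_isTri hb.2.2 (by omega)).symm⟩
    · exact ⟨adj_of_isTri (hn j (by omega)).1 (by omega),
        (adj_of_isTri (hs j (by omega)).2.2 (by omega)).symm⟩
  · have := (hn j hj).2.1
    rw [show 5 + j = 4 + (j + 1) by omega] at this
    exact adj_of_isTri this (by omega)

/-- The vertices with numbers `a` and `b` are connected by a path that avoids `T`. -/
def Joined (T : Finset (Fin (l + 6))) (a b : ℕ) : Prop :=
  ∃ (ha : vert l a ∉ T) (hb : vert l b ∉ T),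
    ((disk l).graph.induce {v | v ∉ T}).Reachable ⟨_, ha⟩ ⟨_, hb⟩

namespace Joined

variable {T : Finset (Fin (l + 6))} {a b c : ℕ}

theorem refl (ha : vert l a ∉ T) : Joined T a a := ⟨ha, ha, .rfl⟩

theorem symm (h : Joined T a b) : Joined T b a := ⟨h.2.1, h.1, h.2.2.symm⟩

theorem trans (h : Joined T a b) (h' : Joined T b c) : Joined T a c :=
  ⟨h.1, h'.2.1, h.2.2.trans h'.2.2⟩

theorem of_nAdj (h : NAdj l a b) (ha : vert l a ∉ T) (hb : vert l b ∉ T) : Joined T a b :=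
  ⟨ha, hb, SimpleGraph.Adj.reachable (SimpleGraph.induce_adj.2 h)⟩

theorem rim {i j : ℕ} (hij : i ≤ j) (hj : j ≤ l + 1)
    (h : ∀ k, i ≤ k → k ≤ j → vert l (4 + k) ∉ T) : Joined T (4 + i) (4 + j) := by
  induction j, hij using Nat.le_induction with
  | base => exact refl (h i le_rfl le_rfl)
  | succ j hij ih =>
    exact (ih (by omega) fun k h1 h2 => h k h1 (by omega)).trans
      (of_nAdj (nAdj_all.2.1 j (by omega)) (h j hij (by omega)) (h (j + 1) (by omega) le_rfl))

end Joined

theorem exists_notMem {T : Finset (Fin (l + 6))} (hT : T.card < 4) {a b c d : ℕ}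
    (ha : a < l + 6) (hb : b < l + 6) (hc : c < l + 6) (hd : d < l + 6)
    (hne : (a ≠ b ∧ a ≠ c ∧ a ≠ d) ∧ (b ≠ c ∧ b ≠ d) ∧ c ≠ d) :
    vert l a ∉ T ∨ vert l b ∉ T ∨ vert l c ∉ T ∨ vert l d ∉ T := by
  by_contra! h
  have hsub : ({vert l a, vert l b, vert l c, vert l d} : Finset (Fin (l + 6))) ⊆ T := by
    intro x
    simp only [Finset.mem_insert, Finset.mem_singleton]
    rintro (rfl | rfl | rfl | rfl)
    exacts [h.1, h.2.1, h.2.2.1, h.2.2.2]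
  have hcard := Finset.card_le_card hsub
  rw [Finset.card_insert_of_notMem, Finset.card_insert_of_notMem, Finset.card_insert_of_notMem,
    Finset.card_singleton] at hcard
  · omega
  all_goals
    simp only [Finset.mem_insert, Finset.mem_singleton, vert_inj ha hb, vert_inj ha hc,
      vert_inj ha hd, vert_inj hb hc, vert_inj hb hd, vert_inj hc hd]
    omega

/-- A surviving apex is adjacent to the whole path, so only the vertices `2` and `3` and the other
apex need a detour. Without apices, at most one further vertex is missing, and `2` or `3` serves as
the root. -/
theorem exists_joined (hl : 1 ≤ l) {T : Finset (Fin (l + 6))} (hT : T.card < 4) :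
    ∃ a, vert l a ∉ T ∧ ∀ b < l + 6, vert l b ∉ T → Joined T a b := by
  obtain ⟨hrim, -, h02, h13, h23, h24, h25, h34, h35⟩ := nAdj_all (l := l)
  have hends : vert l 4 ∉ T ∨ vert l (4 + (l + 1)) ∉ T → ∀ c, vert l c ∉ T → NAdj l c 4 →
      NAdj l c (4 + (l + 1)) → ∀ a, vert l a ∉ T → NAdj l a 4 → NAdj l a (4 + (l + 1)) →
      Joined T a c := by
    intro h c hc h1 h2 a ha h3 h4
    rcases h with h | h
    · exact (Joined.of_nAdj h3 ha h).trans (Joined.of_nAdj h1 hc h).symm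
    · exact (Joined.of_nAdj h4 ha h).trans (Joined.of_nAdj h2 hc h).symm
  have cover : ∀ {P : ℕ → Prop}, P 0 → P 1 → P 2 → P 3 → (∀ i ≤ l + 1, P (4 + i)) →
      ∀ b < l + 6, P b := by
    intro P p0 p1 p2 p3 h b hb
    rcases lt_or_ge b 4 with hb4 | hb4
    · interval_cases b <;> assumption
    · obtain ⟨i, rfl⟩ := Nat.exists_eq_add_of_le hb4
      exact h i (by omega)
  have n04 : NAdj l 0 4 := (hrim 0 (by omega)).1
  have n14 : NAdj l 1 4 := (hrim 0 (by omega)).2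
  have n05 := (hrim (l + 1) le_rfl).1
  have n15 := (hrim (l + 1) le_rfl).2
  by_cases m0 : vert l 0 ∈ T <;> by_cases m1 : vert l 1 ∈ T
  · have only : ∀ {a b : ℕ}, 2 ≤ a → 2 ≤ b → a < l + 6 → b < l + 6 → a ≠ b →
        vert l a ∉ T ∨ vert l b ∉ T := fun h1 h2 h3 h4 hne => by
      simpa [m0, m1] using exists_notMem hT (a := 0) (b := 1) (by omega) (by omega) h3 h4 (by omega)
    have hub : ∀ c, vert l c ∉ T → NAdj l c 4 → NAdj l c (4 + (l + 1)) → ∀ i ≤ l + 1,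
        vert l (4 + i) ∉ T → Joined T c (4 + i) := by
      intro c hc h1 h2 i hi hiT
      -- At most one path vertex is removed, so one of the two directions from `4 + i` to an end of
      -- the path is free.
      by_cases hlow : ∀ k ≤ i, vert l (4 + k) ∉ T
      · exact (Joined.of_nAdj h1 hc (hlow 0 (Nat.zero_le i))).trans
          (Joined.rim (Nat.zero_le i) hi fun k _ hk => hlow k hk)
      · push Not at hlow
        obtain ⟨k, hk, hkT⟩ := hlow
        have hup : ∀ k', i ≤ k' → k' ≤ l + 1 → vert l (4 + k') ∉ T := by
          intro k' h3 h4
          rcases h3.eq_or_lt with rfl | h3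
          · exact hiT
          · exact (only (a := 4 + k) (b := 4 + k') (by omega) (by omega) (by omega) (by omega)
              (by omega)).resolve_left (not_not.2 hkT)
        exact (Joined.of_nAdj h2 hc (hup _ hi le_rfl)).trans (Joined.rim hi le_rfl hup).symm
    rcases only (a := 2) (b := 3) (by omega) (by omega) (by omega) (by omega) (by omega) with m | m
    · exact ⟨2, m, cover (absurd m0) (absurd m1) Joined.refl (Joined.of_nAdj h23 m)
        (hub 2 m h24 h25)⟩
    · exact ⟨3, m, cover (absurd m0) (absurd m1) (fun m2 => (Joined.of_nAdj h23 m2 m).symm)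
        Joined.refl (hub 3 m h34 h35)⟩
  · refine ⟨1, m1, cover (absurd m0) Joined.refl (fun m2 => ?_) (Joined.of_nAdj h13 m1)
      fun i hi h => Joined.of_nAdj (hrim i hi).2 m1 h⟩
    rcases exists_notMem hT (a := 0) (b := 3) (c := 4) (d := 4 + (l + 1)) (by omega) (by omega)
      (by omega) (by omega) (by omega) with h | h | h
    · exact absurd m0 h
    · exact (Joined.of_nAdj h13 m1 h).trans (Joined.of_nAdj h23 m2 h).symm
    · exact hends h 2 m2 h24 h25 1 m1 n14 n15
  · refine ⟨0, m0, cover Joined.refl (absurd m1) (Joined.of_nAdj h02 m0) (fun m3 => ?_)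
      fun i hi h => Joined.of_nAdj (hrim i hi).1 m0 h⟩
    rcases exists_notMem hT (a := 1) (b := 2) (c := 4) (d := 4 + (l + 1)) (by omega) (by omega)
      (by omega) (by omega) (by omega) with h | h | h
    · exact absurd m1 h
    · exact (Joined.of_nAdj h02 m0 h).trans (Joined.of_nAdj h23 h m3)
    · exact hends h 3 m3 h34 h35 0 m0 n04 n05
  · have h01 : Joined T 0 1 := by
      by_cases h : ∃ i ≤ l + 1, vert l (4 + i) ∉ T
      · obtain ⟨i, hi, h⟩ := h
        exact (Joined.of_nAdj (hrim i hi).1 m0 h).trans (Joined.of_nAdj (hrim i hi).2 m1 h).symm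
      -- The whole path is removed. It has at least three vertices because `1 ≤ l`, so `T` contains
      -- nothing else and the way through `2` and `3` is free.
      · push Not at h
        have only : ∀ a, a = 2 ∨ a = 3 → vert l a ∉ T := fun a ha => by
          simpa [h 0 (by omega), h 1 (by omega), h 2 (by omega)] using exists_notMem hT (a := 4 + 0)
            (b := 4 + 1) (c := 4 + 2) (d := a) (by omega) (by omega) (by omega) (by omega)
            (by omega)
        have m2 := only 2 (Or.inl rfl)
        have m3 := only 3 (Or.inr rfl)
        exact ((Joined.of_nAdj h02 m0 m2).trans (Joined.of_nAdj h23 m2 m3)).trans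
          (Joined.of_nAdj h13 m1 m3).symm
    exact ⟨0, m0, cover Joined.refl (fun _ => h01) (Joined.of_nAdj h02 m0)
      (fun m3 => h01.trans (Joined.of_nAdj h13 m1 m3)) fun i hi h =>
        Joined.of_nAdj (hrim i hi).1 m0 h⟩

theorem isVertexConnected_disk (hl : 1 ≤ l) : IsVertexConnected (disk l).graph 4 := by
  refine ⟨by rw [Fintype.card_fin]; omega, fun T hT => ?_⟩
  obtain ⟨a, ha, h⟩ := exists_joined hl hT
  refine (SimpleGraph.connected_iff_exists_forall_reachable _).2 ⟨⟨_, ha⟩, ?_⟩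
  rintro ⟨v, hv⟩
  obtain ⟨b, hb, rfl⟩ : ∃ b, b < l + 6 ∧ vert l b = v := ⟨v, v.2, vert_val v⟩
  exact (h b hb hv).2.2

/-! ### Generic perturbation of the areas -/

theorem eventually_quadratic_ne_zero (b c : ℝ) : ∀ᶠ x : ℝ in 𝓝[>] 0, x * x + b * x + c ≠ 0 := by
  by_cases hc : c = 0
  · have : ∀ᶠ x : ℝ in 𝓝[>] 0, x + b ≠ 0 := by
      by_cases hb : b = 0
      · filter_upwards [self_mem_nhdsWithin] with x hx
        rw [hb, add_zero]
        exact ne_of_gt hx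
      · have h : Continuous fun x : ℝ => x + b := by fun_prop
        exact ((h.tendsto 0).mono_left nhdsWithin_le_nhds).eventually_ne (by simpa using hb)
    filter_upwards [this, self_mem_nhdsWithin] with x h1 h2
    rw [hc, add_zero, ← add_mul]
    exact mul_ne_zero h1 (ne_of_gt h2)
  · have h : Continuous fun x : ℝ => x * x + b * x + c := by fun_prop
    exact ((h.tendsto 0).mono_left nhdsWithin_le_nhds).eventually_ne (by simpa using hc)

/-- The placement with the apices `(0, 0)` and `(1, 0)`. -/
def position (v : ℕ → ℝ × ℝ) (Y W : ℝ × ℝ) : ℕ → ℝ × ℝ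
  | 0 => 0
  | 1 => (1, 0)
  | 2 => Y
  | 3 => W
  | i + 4 => v i

theorem exists_approx (hl : 1 ≤ l) (A : Face l → ℝ) (hA : ∀ f, 0 ≤ A f) {δ : ℝ} (hδ : 0 < δ) :
    ∃ q, (disk l).Oriented q ∧ ∀ f, |turn ((disk l).face q f 0) ((disk l).face q f 1)
      ((disk l).face q f 2) - A f| < δ := by
  -- The strip is described by infinite sequences; the default 0 becomes positive after the
  -- perturbation.
  let a : ℕ → ℝ := fun i => if h : i < l + 1 then A (.inl ⟨i, h⟩) else 0
  let b : ℕ → ℝ := fun i => if h : i < l + 1 then A (.inr (.inl ⟨i, h⟩)) else 0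
  have ha : ∀ i, 0 ≤ a i := fun i => by
    simp only [a]
    split_ifs
    exacts [hA _, le_rfl]
  have hb : ∀ i, 0 ≤ b i := fun i => by
    simp only [b]
    split_ifs
    exacts [hA _, le_rfl]
  let c : Fin 5 → ℝ := fun j => A (.inr (.inr j))
  have hc : ∀ j, 0 ≤ c j := fun j => hA _
  -- The perturbations `ε` and `(i + 1) * ε` are chosen so that the difference of the two sides is a
  -- quadratic in `ε` with leading coefficient `(i + 2) - (i + 1) = 1`.
  have ev1 : ∀ᶠ ε : ℝ in 𝓝[>] 0, ∀ i < l,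
      (a i + ε) * (b (i + 1) + ((i : ℝ) + 2) * ε) ≠
        (a (i + 1) + ε) * (b i + ((i : ℝ) + 1) * ε) := by
    have : ∀ᶠ ε : ℝ in 𝓝[>] 0, ∀ i ∈ Finset.range l,
        (a i + ε) * (b (i + 1) + ((i : ℝ) + 2) * ε) ≠
          (a (i + 1) + ε) * (b i + ((i : ℝ) + 1) * ε) := by
      refine (Finset.eventually_all _).2 fun i _ => ?_
      filter_upwards [eventually_quadratic_ne_zero (a i * ((i : ℝ) + 2) + b (i + 1) -
        a (i + 1) * ((i : ℝ) + 1) - b i) (a i * b (i + 1) - a (i + 1) * b i)] with ε h1 h2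
      apply h1
      linear_combination h2
    filter_upwards [this] with ε h i hi using h i (Finset.mem_range.2 hi)
  -- Doubling one of the four perturbations gives the leading coefficient `2 - 1 = 1`.
  have ev2 : ∀ᶠ ε : ℝ in 𝓝[>] 0,
      (c 2 + 2 * ε) * (c 1 + ε) - (c 0 + ε) * (c 3 + ε) ≠ 0 := by
    filter_upwards [eventually_quadratic_ne_zero (c 2 + 2 * c 1 - c 0 - c 3)
      (c 2 * c 1 - c 0 * c 3)] with ε h1 h2
    apply h1
    linear_combination h2
  have ev3 : ∀ᶠ ε : ℝ in 𝓝[>] 0, ((l : ℝ) + 2) * ε < δ := by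
    have h : Continuous fun x : ℝ => ((l : ℝ) + 2) * x := by fun_prop
    exact ((h.tendsto 0).mono_left nhdsWithin_le_nhds).eventually (gt_mem_nhds (by simpa using hδ))
  obtain ⟨ε, ⟨⟨h1, h2⟩, h3⟩, hε⟩ := (((ev1.and ev2).and ev3).and self_mem_nhdsWithin).exists
  have hε : 0 < ε := hε
  have hle : ∀ i ≤ l, ((i : ℝ) + 1) * ε < δ := fun i hi => by
    have : (i : ℝ) ≤ l := Nat.cast_le.2 hi
    nlinarith
  have hle1 : ε < δ := by simpa using hle 0 (Nat.zero_le l)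
  have hle2 : 2 * ε < δ := by
    have := hle 1 hl
    norm_num at this
    linarith
  obtain ⟨v, W, Y, hv, hp, hq, hr, ht, hB⟩ := Strip.exists_realization (l := l)
    (α := fun i => a i + ε) (β := fun i => b i + ((i : ℝ) + 1) * ε) (by omega)
    (fun i => by have := ha i; positivity) (fun i => by have := hb i; positivity)
    (p := c 0 + ε) (q := c 1 + ε) (r := c 2 + 2 * ε) (t := c 3 + ε) (B := c 4 + ε)
    (by linarith [hc 0]) (by linarith [hc 1]) (by linarith [hc 2]) (by linarith [hc 3])
    (by linarith [hc 4]) h2 fun i hi => by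
      have := h1 i hi
      push_cast
      rwa [add_assoc (i : ℝ) 1 1, one_add_one_eq_two]
  have key : ∀ f, 0 < turn ((disk l).face (fun x => position v Y W x) f 0)
      ((disk l).face (fun x => position v Y W x) f 1)
      ((disk l).face (fun x => position v Y W x) f 2) ∧
      |turn ((disk l).face (fun x => position v Y W x) f 0)
        ((disk l).face (fun x => position v Y W x) f 1)
        ((disk l).face (fun x => position v Y W x) f 2) - A f| < δ := by
    have close : ∀ {x y z : ℝ}, 0 ≤ y → 0 < z → z < δ → x = y + z → 0 < x ∧ |x - y| < δ := by
      rintro x y z hy hz hzδ rfl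
      refine ⟨by linarith, ?_⟩
      rwa [add_sub_cancel_left, abs_of_pos hz]
    have pf : ∀ f k, (disk l).face (fun x => position v Y W x) f k =
        position v Y W (tri l f k) := fun f k => by
      show position v Y W (vert l (tri l f k) : Fin (l + 6)) = _
      rw [val_vert (tri_lt f k)]
    have e4 : ∀ i, position v Y W (4 + i) = v i := fun i => by rw [add_comm]; rfl
    have e5 : ∀ i, position v Y W (5 + i) = v (i + 1) := fun i => by
      rw [show 5 + i = i + 1 + 4 by omega]; rfl
    simp only [pf]
    rintro (i | i | j)
    · have hi := Nat.le_of_lt_succ i.2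
      refine close (hA _) hε hle1 ?_
      have := (hv i hi).1
      simp only [a, dif_pos i.2] at this
      rw [← this, ← e5, ← e4]
      rfl
    · have hi := Nat.le_of_lt_succ i.2
      refine close (hA _) (z := ((i : ℝ) + 1) * ε) (by positivity) (hle i hi) ?_
      have := (hv i hi).2
      simp only [b, dif_pos i.2] at this
      rw [← this, ← e5, ← e4]
      rfl
    · fin_cases j
      exacts [close (hA _) hε hle1 hp, close (hA _) hε hle1 hq,
        close (hA _) (by linarith) hle2 hr, close (hA _) hε hle1 ht, close (hA _) hε hle1 hB]
  exact ⟨_, fun f => (key f).1, fun f => (key f).2⟩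

end Accordion

theorem corollary2 (n : ℕ) (hn : 7 ≤ n) :
    ∃ T : PlaneTriangulation (Fin n), IsVertexConnected T.graph 4 ∧ T.AreaUniversal := by
  obtain ⟨l, rfl⟩ := Nat.exists_eq_add_of_le' (show 6 ≤ n by omega)
  have hl : 1 ≤ l := by omega
  -- Any oriented placement may serve as the reference drawing; the areas and the tolerance are
  -- arbitrary here.
  obtain ⟨p, hp, -⟩ := Accordion.exists_approx hl 0 (fun _ => le_rfl) one_pos
  exact ⟨hp.toPlaneTriangulation, Accordion.isVertexConnected_disk hl,
    hp.areaUniversal fun A hA _ hδ => Accordion.exists_approx hl A hA hδ⟩
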